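/- Let $1 < p < \infty$, let $\Gamma$ be an arbitrary infinite set, and let $w : \Gamma \to (0,\infty)$ be an arbitrary function. Let $\mu$ be the measure on the power set of $\Gamma$ given by $\mu(A) = \sum_{\gamma \in A} w(\gamma)$, and let $\ell^{p,\infty}(\Gamma,w)$ be the space of all functions $f : \Gamma \to \mathbb{R}$ with $$\|f\| = \sup_{c>0} c\,\bigl(\mu\{\gamma \in \Gamma : |f(\gamma)| > c\}\bigr)^{1/p} < \infty ,$$ which is a Banach space under a norm equivalent to the quasi-norm $\|\cdot\|$. Then $\ell^{p,\infty}(\Gamma,w)$ is isomorphic (that is, linearly homeomorphic) to its square $\ell^{p,\infty}(\Gamma,w) \oplus \ell^{p,\infty}(\Gamma,w)$. -/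

import Mathlib

open MeasureTheory Set
open scoped ENNReal

/-- The weak `L^p` quasi-norm `sup_{c > 0} c * μ {|f| > c} ^ (1 / p)`, with values in `[0, ∞]`. -/
noncomputable def weakLpQuasiNorm {Ω : Type*} [MeasurableSpace Ω] (p : ℝ) (μ : Measure Ω)
    (f : Ω → ℝ) : ℝ≥0∞ :=
  ⨆ (c : ℝ) (_ : 0 < c), ENNReal.ofReal c * μ {x | c < |f x|} ^ (1 / p)

/-- The measure `μ A = ∑_{γ ∈ A} w γ`, defined on all subsets of `Γ`, of a weight
`w : Γ → (0, ∞)`. -/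
noncomputable def weightMeasure {Γ : Type*} (w : Γ → Ioi (0 : ℝ)) : @Measure Γ ⊤ :=
  letI : MeasurableSpace Γ := ⊤
  Measure.sum fun γ => ENNReal.ofReal (w γ) • Measure.dirac γ

theorem weightMeasure_apply {Γ : Type*} (w : Γ → Ioi (0 : ℝ)) (A : Set Γ) :
    weightMeasure w A = ∑' γ : A, ENNReal.ofReal (w γ) := by
  let _ : MeasurableSpace Γ := ⊤
  have hA : MeasurableSet A := trivial
  rw [tsum_subtype A (fun γ => ENNReal.ofReal (w γ))]
  simp only [weightMeasure]
  rw [Measure.sum_apply _ hA]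
  refine tsum_congr fun γ => ?_
  by_cases h : γ ∈ A <;> simp [Measure.dirac_apply' _ hA, h]

theorem weightMeasure_finset {Γ : Type*} (w : Γ → Ioi (0 : ℝ)) (A : Finset Γ) :
    weightMeasure w A = ∑ γ ∈ A, ENNReal.ofReal (w γ) := by
  rw [weightMeasure_apply]
  exact Finset.tsum_subtype A (fun γ => ENNReal.ofReal (w γ))

theorem weightMeasure_eq_iSup {Γ : Type*} (w : Γ → Ioi (0 : ℝ)) (A : Set Γ) :
    weightMeasure w A = ⨆ (B : Finset Γ) (_ : (B : Set Γ) ⊆ A), weightMeasure w B := by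
  classical
  let _ : MeasurableSpace Γ := ⊤
  apply le_antisymm
  · rw [weightMeasure_apply, ENNReal.tsum_eq_iSup_sum]
    refine iSup_le fun s => ?_
    refine le_iSup₂_of_le (s.map (Function.Embedding.subtype _)) ?_ ?_
    · intro x hx
      simp only [Finset.coe_map, mem_image, Function.Embedding.subtype_apply] at hx
      obtain ⟨y, -, rfl⟩ := hx
      exact y.2
    · rw [weightMeasure_finset, Finset.sum_map]
      rfl
  · exact iSup₂_le fun B hB => measure_mono hB

theorem weightMeasure_finset_ne_top {Γ : Type*} (w : Γ → Ioi (0 : ℝ)) (A : Finset Γ) :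
    weightMeasure w A ≠ ∞ := by
  rw [weightMeasure_finset]
  simp

theorem weightMeasure_finset_ne_zero {Γ : Type*} (w : Γ → Ioi (0 : ℝ)) {A : Finset Γ}
    (hA : A.Nonempty) : weightMeasure w A ≠ 0 := by
  rw [weightMeasure_finset]
  obtain ⟨γ, hγ⟩ := hA
  intro h
  rw [Finset.sum_eq_zero_iff] at h
  have h1 := h γ hγ
  rw [ENNReal.ofReal_eq_zero] at h1
  exact absurd (w γ).2 (not_lt.mpr h1)

/-- The norm `sup_A μ(A) ^ (1 / p - 1) * ∫_A |f| dμ`, over finite sets `A ⊆ Γ`, with values in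
`[0, ∞]`. It is equivalent to the weak `L^p` quasi-norm: see `weakLpQuasiNorm_le` and
`weakEllENorm_le`. -/
noncomputable def weakEllENorm {Γ : Type*} (p : ℝ) (w : Γ → Ioi (0 : ℝ)) (f : Γ → ℝ) : ℝ≥0∞ :=
  ⨆ A : Finset Γ, weightMeasure w A ^ (1 / p - 1) * ∑ γ ∈ A, ENNReal.ofReal (w γ * |f γ|)

theorem weakLpQuasiNorm_le {Γ : Type*} {p : ℝ} (hp : 1 < p) (w : Γ → Ioi (0 : ℝ)) (f : Γ → ℝ) :
    @weakLpQuasiNorm Γ ⊤ p (weightMeasure w) f ≤ weakEllENorm p w f := by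
  let _ : MeasurableSpace Γ := ⊤
  have hp0 : 0 < 1 / p := by positivity
  refine iSup₂_le fun c hc => ?_
  have key : ∀ B : Finset Γ, (B : Set Γ) ⊆ {x | c < |f x|} →
      ENNReal.ofReal c * weightMeasure w B ^ (1 / p) ≤ weakEllENorm p w f := by
    intro B hB
    rcases B.eq_empty_or_nonempty with rfl | hne
    · simp [hp0, ENNReal.zero_rpow_of_pos, -one_div]
    · refine le_trans ?_ (le_iSup (fun A : Finset Γ => weightMeasure w A ^ (1 / p - 1) *
        ∑ γ ∈ A, ENNReal.ofReal (w γ * |f γ|)) B)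
      have h0 := weightMeasure_finset_ne_zero w hne
      have ht := weightMeasure_finset_ne_top w B
      have e : weightMeasure w B ^ (1 / p)
          = weightMeasure w B ^ (1 / p - 1) * weightMeasure w B := by
        conv_rhs => rw [← ENNReal.rpow_one (weightMeasure w (B : Set Γ)), ENNReal.rpow_one,
          ← ENNReal.rpow_one (weightMeasure w (B : Set Γ)), ← ENNReal.rpow_mul,
          ← ENNReal.rpow_add _ _ h0 ht]
        ring_nf
      rw [e, mul_left_comm]
      gcongr
      rw [weightMeasure_finset, Finset.mul_sum]
      refine Finset.sum_le_sum fun γ hγ => ?_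
      rw [← ENNReal.ofReal_mul hc.le, mul_comm c]
      refine ENNReal.ofReal_le_ofReal ?_
      exact mul_le_mul_of_nonneg_left (le_of_lt (hB hγ)) (le_of_lt (w γ).2)
  by_cases hN : weakEllENorm p w f = ∞
  · simp [hN]
  have hc0 : ENNReal.ofReal c ≠ 0 := by simpa using hc
  have hct : ENNReal.ofReal c ≠ ∞ := ENNReal.ofReal_ne_top
  have h2 : weightMeasure w {x | c < |f x|} ≤ (weakEllENorm p w f / ENNReal.ofReal c) ^ p := by
    rw [weightMeasure_eq_iSup]
    refine iSup₂_le fun B hB => ?_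
    have h3 := key B hB
    rw [mul_comm, ← ENNReal.le_div_iff_mul_le (Or.inl hc0) (Or.inl hct)] at h3
    rw [one_div, ENNReal.rpow_inv_le_iff (by linarith)] at h3
    exact h3
  have h4 : weightMeasure w {x | c < |f x|} ^ (1 / p) ≤ weakEllENorm p w f / ENNReal.ofReal c := by
    rw [one_div, ENNReal.rpow_inv_le_iff (by linarith)]
    exact h2
  rw [ENNReal.le_div_iff_mul_le (Or.inl hc0) (Or.inl hct), mul_comm] at h4
  exact h4

theorem weakEllENorm_le {Γ : Type*} {p : ℝ} (hp : 1 < p) (w : Γ → Ioi (0 : ℝ)) (f : Γ → ℝ) :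
    weakEllENorm p w f
      ≤ ENNReal.ofReal (p / (p - 1)) * @weakLpQuasiNorm Γ ⊤ p (weightMeasure w) f := by
  let _ : MeasurableSpace Γ := ⊤
  have hp0 : 0 < p := by linarith
  have hp1 : 0 < p - 1 := by linarith
  set Q := weakLpQuasiNorm p (weightMeasure w) f with hQ
  by_cases hQt : Q = ∞
  · rw [hQt, ENNReal.mul_top]
    · exact le_top
    · simp only [ne_eq, ENNReal.ofReal_eq_zero, not_le]; positivity
  -- it suffices to bound by any real number above the quasi-norm
  suffices H : ∀ q : ℝ, 0 < q → Q ≤ ENNReal.ofReal q →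
      weakEllENorm p w f ≤ ENNReal.ofReal (p / (p - 1) * q) by
    have hlim : Filter.Tendsto (fun n : ℕ => ENNReal.ofReal (p / (p - 1) * (Q.toReal + 1 / (n + 1))))
        Filter.atTop (nhds (ENNReal.ofReal (p / (p - 1) * (Q.toReal + 0)))) :=
      ENNReal.tendsto_ofReal
        ((tendsto_const_nhds.add tendsto_one_div_add_atTop_nhds_zero_nat).const_mul _)
    have h5 := ge_of_tendsto' (b := weakEllENorm p w f) hlim fun n => by
      refine H _ (by positivity) ?_
      rw [ENNReal.le_ofReal_iff_toReal_le hQt (by positivity)]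
      have : (0 : ℝ) ≤ 1 / (n + 1) := by positivity
      linarith
    rwa [add_zero, ENNReal.ofReal_mul (by positivity), ENNReal.ofReal_toReal hQt] at h5
  intro q hq hQq
  refine iSup_le fun A => ?_
  rcases A.eq_empty_or_nonempty with rfl | hne
  · simp
  have h0 := weightMeasure_finset_ne_zero w hne
  have ht := weightMeasure_finset_ne_top w A
  obtain ⟨a, ha, hae⟩ : ∃ a : ℝ, 0 < a ∧ weightMeasure w (A : Set Γ) = ENNReal.ofReal a :=
    ⟨_, ENNReal.toReal_pos h0 ht, (ENNReal.ofReal_toReal ht).symm⟩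
  set c : ℝ := q * a ^ (-(1 / p)) with hc
  have hc0 : 0 < c := by positivity
  have hsum : ∑ γ ∈ A, ENNReal.ofReal (w γ * |f γ|)
      = ∫⁻ t in Ioi (0 : ℝ), ((weightMeasure w).restrict A) {x | t < |f x|} := by
    rw [← lintegral_eq_lintegral_meas_lt _ (Filter.Eventually.of_forall fun x => abs_nonneg (f x))
      (measurable_from_top.aemeasurable)]
    rw [weightMeasure, ← lintegral_indicator (MeasurableSpace.measurableSet_top (s := (A : Set Γ))), lintegral_sum_measure]
    rw [tsum_eq_sum (s := A)]
    · refine Finset.sum_congr rfl fun γ hγ => ?_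
      rw [lintegral_smul_measure, lintegral_dirac' _ measurable_from_top,
        ENNReal.ofReal_mul (le_of_lt (w γ).2), indicator_of_mem (by exact hγ)]
      rfl
    · intro γ hγ
      rw [lintegral_smul_measure, lintegral_dirac' _ measurable_from_top,
        indicator_of_notMem (by exact hγ), smul_zero]
  have hb1 : ∀ t : ℝ, ((weightMeasure w).restrict A) {x | t < |f x|} ≤ ENNReal.ofReal a := by
    intro t
    rw [← hae, ← Measure.restrict_apply_univ (μ := weightMeasure w) (A : Set Γ)]
    exact measure_mono (subset_univ _)
  have hb2 : ∀ t : ℝ, c < t → ((weightMeasure w).restrict A) {x | t < |f x|}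
      ≤ ENNReal.ofReal (q ^ p * t ^ (-p)) := by
    intro t hct
    have ht0 : 0 < t := hc0.trans hct
    refine (Measure.restrict_apply_le _ _).trans ?_
    have h6 : ENNReal.ofReal t * weightMeasure w {x | t < |f x|} ^ (1 / p) ≤ ENNReal.ofReal q :=
      le_trans (le_iSup₂_of_le (f := fun (c : ℝ) (_ : 0 < c) =>
        ENNReal.ofReal c * weightMeasure w {x | c < |f x|} ^ (1 / p)) t ht0 le_rfl) hQq
    rw [mul_comm, ← ENNReal.le_div_iff_mul_le (Or.inl (by simpa using ht0))
      (Or.inl ENNReal.ofReal_ne_top), one_div, ENNReal.rpow_inv_le_iff hp0,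
      ← ENNReal.ofReal_div_of_pos ht0, ENNReal.ofReal_rpow_of_pos (by positivity),
      Real.div_rpow hq.le ht0.le, div_eq_mul_inv, ← Real.rpow_neg ht0.le] at h6
    exact h6
  have hint : ∑ γ ∈ A, ENNReal.ofReal (w γ * |f γ|)
      ≤ ENNReal.ofReal (a * c + q ^ p * (c ^ (1 - p) / (p - 1))) := by
    rw [hsum, ← Ioc_union_Ioi_eq_Ioi hc0.le, lintegral_union measurableSet_Ioi
      (Ioc_disjoint_Ioi le_rfl), ENNReal.ofReal_add (by positivity) (by positivity)]
    refine add_le_add ?_ ?_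
    · refine (lintegral_mono hb1).trans ?_
      rw [lintegral_const, ENNReal.ofReal_mul ha.le]
      simp
    · refine (setLIntegral_mono (s := Ioi c)
        (g := fun t : ℝ => ENNReal.ofReal (q ^ p * t ^ (-p))) (by fun_prop)
        (fun t ht => hb2 t (mem_Ioi.1 ht))).trans ?_
      rw [← ofReal_integral_eq_lintegral_ofReal, integral_const_mul,
        integral_Ioi_rpow_of_lt (by linarith) hc0]
      · refine ENNReal.ofReal_le_ofReal (le_of_eq ?_)
        congr 1
        rw [show -p + 1 = -(p - 1) by ring, neg_div_neg_eq, neg_sub]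
      · exact (integrableOn_Ioi_rpow_of_lt (by linarith) hc0).const_mul _
      · filter_upwards [ae_restrict_mem measurableSet_Ioi] with t ht
        have : 0 < t := hc0.trans ht
        positivity
  calc _ ≤ ENNReal.ofReal (a ^ (1 / p - 1))
        * ENNReal.ofReal (a * c + q ^ p * (c ^ (1 - p) / (p - 1))) := by
        rw [hae, ENNReal.ofReal_rpow_of_pos ha]
        gcongr
    _ = ENNReal.ofReal (p / (p - 1) * q) := by
        rw [← ENNReal.ofReal_mul (by positivity)]
        congr 1
        have e1 : a ^ (1 / p - 1) * (a * c) = q := by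
          rw [hc, ← mul_assoc, ← Real.rpow_add_one ha.ne', mul_left_comm, ← Real.rpow_add ha]
          simp
        have e2 : a ^ (1 / p - 1) * (q ^ p * c ^ (1 - p)) = q := by
          rw [hc, Real.mul_rpow hq.le (by positivity), ← mul_assoc (q ^ p), ← Real.rpow_add hq,
            ← Real.rpow_mul ha.le, mul_left_comm, ← Real.rpow_add ha]
          have : 1 / p - 1 + -(1 / p) * (1 - p) = 0 := by field_simp; ring
          rw [this]
          simp
        rw [mul_add, e1, ← mul_div_assoc, ← mul_div_assoc, e2]
        field_simp
        ring

theorem weakEllENorm_zero {Γ : Type*} (p : ℝ) (w : Γ → Ioi (0 : ℝ)) :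
    weakEllENorm p w 0 = 0 := by
  simp [weakEllENorm]

theorem weakEllENorm_add_le {Γ : Type*} (p : ℝ) (w : Γ → Ioi (0 : ℝ)) (f g : Γ → ℝ) :
    weakEllENorm p w (f + g) ≤ weakEllENorm p w f + weakEllENorm p w g := by
  refine iSup_le fun A => ?_
  refine le_trans ?_ (add_le_add
    (le_iSup (fun A : Finset Γ => weightMeasure w A ^ (1 / p - 1) *
      ∑ γ ∈ A, ENNReal.ofReal (w γ * |f γ|)) A)
    (le_iSup (fun A : Finset Γ => weightMeasure w A ^ (1 / p - 1) *
      ∑ γ ∈ A, ENNReal.ofReal (w γ * |g γ|)) A))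
  rw [← mul_add, ← Finset.sum_add_distrib]
  gcongr with γ
  have := (w γ).2
  rw [mem_Ioi] at this
  rw [← ENNReal.ofReal_add (by positivity) (by positivity), ← mul_add]
  refine ENNReal.ofReal_le_ofReal ?_
  gcongr
  exact abs_add_le _ _

theorem weakEllENorm_smul {Γ : Type*} (p : ℝ) (w : Γ → Ioi (0 : ℝ)) (r : ℝ) (f : Γ → ℝ) :
    weakEllENorm p w (r • f) = ENNReal.ofReal |r| * weakEllENorm p w f := by
  rw [weakEllENorm, weakEllENorm, ENNReal.mul_iSup]
  refine iSup_congr fun A => ?_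
  rw [mul_left_comm]
  congr 1
  rw [Finset.mul_sum]
  refine Finset.sum_congr rfl fun γ _ => ?_
  rw [← ENNReal.ofReal_mul (abs_nonneg r), Pi.smul_apply, smul_eq_mul, abs_mul, mul_left_comm]

theorem eq_zero_of_weakEllENorm_eq_zero {Γ : Type*} {p : ℝ} {w : Γ → Ioi (0 : ℝ)} {f : Γ → ℝ}
    (h : weakEllENorm p w f = 0) : f = 0 := by
  funext γ
  have h1 : weightMeasure w (({γ} : Finset Γ) : Set Γ) ^ (1 / p - 1)
      * ∑ x ∈ ({γ} : Finset Γ), ENNReal.ofReal (w x * |f x|) = 0 :=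
    (ENNReal.iSup_eq_zero.1 h) {γ}
  have hγ : (0 : ℝ) < w γ := (w γ).2
  have h2 := weightMeasure_finset_ne_zero w (Finset.singleton_nonempty γ)
  have h3 := weightMeasure_finset_ne_top w {γ}
  rcases mul_eq_zero.1 h1 with h4 | h4
  · rw [ENNReal.rpow_eq_zero_iff] at h4
    tauto
  · rw [Finset.sum_singleton, ENNReal.ofReal_eq_zero] at h4
    by_contra hf
    have : 0 < |f γ| := abs_pos.2 hf
    exact absurd h4 (not_le.2 (by positivity))

theorem weakLpQuasiNorm_lt_top_iff {Γ : Type*} {p : ℝ} (hp : 1 < p) (w : Γ → Ioi (0 : ℝ))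
    (f : Γ → ℝ) :
    @weakLpQuasiNorm Γ ⊤ p (weightMeasure w) f < ∞ ↔ weakEllENorm p w f < ∞ :=
  ⟨fun h => (weakEllENorm_le hp w f).trans_lt (ENNReal.mul_lt_top ENNReal.ofReal_lt_top h),
    fun h => (weakLpQuasiNorm_le hp w f).trans_lt h⟩

/-- The functions on `Γ` with finite weak `L^p` quasi-norm, as a space of functions. -/
noncomputable def weakEllSubmodule {Γ : Type*} (p : ℝ) [hp : Fact (1 < p)]
    (w : Γ → Ioi (0 : ℝ)) : Submodule ℝ (Γ → ℝ) where
  carrier := {f | @weakLpQuasiNorm Γ ⊤ p (weightMeasure w) f < ∞}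
  zero_mem' := by
    rw [mem_ofPred_eq, weakLpQuasiNorm_lt_top_iff hp.out, weakEllENorm_zero]
    exact ENNReal.zero_lt_top
  add_mem' := by
    intro f g hf hg
    rw [mem_ofPred_eq, weakLpQuasiNorm_lt_top_iff hp.out] at hf hg ⊢
    exact (weakEllENorm_add_le p w f g).trans_lt (ENNReal.add_lt_top.2 ⟨hf, hg⟩)
  smul_mem' := by
    intro r f hf
    rw [mem_ofPred_eq, weakLpQuasiNorm_lt_top_iff hp.out] at hf ⊢
    rw [weakEllENorm_smul]
    exact ENNReal.mul_lt_top ENNReal.ofReal_lt_top hf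

/-- The space `ℓ^{p,∞}(Γ, w)`. Every point of `Γ` has positive measure, so functions need not be
identified almost everywhere. This is a type of its own, so that it does not inherit the topology
of pointwise convergence. -/
def WeakEll {Γ : Type*} (p : ℝ) [Fact (1 < p)] (w : Γ → Ioi (0 : ℝ)) : Type _ :=
  weakEllSubmodule p w

noncomputable instance WeakEll.instAddCommGroup {Γ : Type*} (p : ℝ) [Fact (1 < p)] (w : Γ → Ioi (0 : ℝ)) :
    AddCommGroup (WeakEll p w) :=
  inferInstanceAs (AddCommGroup (weakEllSubmodule p w))

noncomputable instance WeakEll.instModule {Γ : Type*} (p : ℝ) [Fact (1 < p)] (w : Γ → Ioi (0 : ℝ)) :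
    Module ℝ (WeakEll p w) :=
  inferInstanceAs (Module ℝ (weakEllSubmodule p w))

/-- The function underlying an element of `ℓ^{p,∞}(Γ, w)`. -/
def WeakEll.val {Γ : Type*} {p : ℝ} [Fact (1 < p)] {w : Γ → Ioi (0 : ℝ)} (f : WeakEll p w) :
    Γ → ℝ :=
  Subtype.val (p := fun g => g ∈ weakEllSubmodule p w) f

theorem WeakEll.weakEllENorm_ne_top {Γ : Type*} {p : ℝ} [hp : Fact (1 < p)] {w : Γ → Ioi (0 : ℝ)}
    (f : WeakEll p w) : weakEllENorm p w f.val ≠ ∞ :=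
  ((weakLpQuasiNorm_lt_top_iff hp.out w f.val).1
    (Subtype.prop (p := fun g => g ∈ weakEllSubmodule p w) f)).ne

noncomputable instance WeakEll.instNorm {Γ : Type*} (p : ℝ) [Fact (1 < p)] (w : Γ → Ioi (0 : ℝ)) :
    Norm (WeakEll p w) where
  norm f := (weakEllENorm p w f.val).toReal

theorem WeakEll.normedSpaceCore {Γ : Type*} (p : ℝ) [Fact (1 < p)] (w : Γ → Ioi (0 : ℝ)) :
    NormedSpace.Core ℝ (WeakEll p w) where
  norm_nonneg f := ENNReal.toReal_nonneg
  norm_smul r f := by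
    change (weakEllENorm p w (r • f.val)).toReal = ‖r‖ * (weakEllENorm p w f.val).toReal
    rw [weakEllENorm_smul, ENNReal.toReal_mul, ENNReal.toReal_ofReal (abs_nonneg r),
      Real.norm_eq_abs]
  norm_triangle f g := by
    change (weakEllENorm p w (f.val + g.val)).toReal
      ≤ (weakEllENorm p w f.val).toReal + (weakEllENorm p w g.val).toReal
    rw [← ENNReal.toReal_add f.weakEllENorm_ne_top g.weakEllENorm_ne_top]
    exact ENNReal.toReal_mono (ENNReal.add_ne_top.2 ⟨f.weakEllENorm_ne_top, g.weakEllENorm_ne_top⟩)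
      (weakEllENorm_add_le p w _ _)
  norm_eq_zero_iff f := by
    change (weakEllENorm p w f.val).toReal = 0 ↔ f = 0
    constructor
    · intro h
      rw [ENNReal.toReal_eq_zero_iff] at h
      exact Subtype.ext (eq_zero_of_weakEllENorm_eq_zero (h.resolve_right f.weakEllENorm_ne_top))
    · rintro rfl
      change (weakEllENorm p w 0).toReal = 0
      rw [weakEllENorm_zero, ENNReal.toReal_zero]

noncomputable instance WeakEll.instNormedAddCommGroup {Γ : Type*} (p : ℝ) [Fact (1 < p)] (w : Γ → Ioi (0 : ℝ)) :
    NormedAddCommGroup (WeakEll p w) :=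
  NormedAddCommGroup.ofCore (WeakEll.normedSpaceCore p w)

noncomputable instance WeakEll.instNormedSpace {Γ : Type*} (p : ℝ) [Fact (1 < p)] (w : Γ → Ioi (0 : ℝ)) :
    NormedSpace ℝ (WeakEll p w) :=
  NormedSpace.ofCore (WeakEll.normedSpaceCore p w)

/-- The norm of `ℓ^{p,∞}(Γ, w)` is equivalent to the weak `L^p` quasi-norm. -/
theorem WeakEll.norm_equiv {Γ : Type*} {p : ℝ} [hp : Fact (1 < p)] {w : Γ → Ioi (0 : ℝ)}
    (f : WeakEll p w) :
    (@weakLpQuasiNorm Γ ⊤ p (weightMeasure w) f.val).toReal ≤ ‖f‖ ∧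
      ‖f‖ ≤ p / (p - 1) * (@weakLpQuasiNorm Γ ⊤ p (weightMeasure w) f.val).toReal := by
  have hp1 : 1 < p := hp.out
  have h0 : 0 < p - 1 := by linarith
  have hq := ((weakLpQuasiNorm_lt_top_iff hp1 w f.val).2 f.weakEllENorm_ne_top.lt_top).ne
  refine ⟨ENNReal.toReal_mono f.weakEllENorm_ne_top (weakLpQuasiNorm_le hp1 w f.val), ?_⟩
  have := ENNReal.toReal_mono (ENNReal.mul_ne_top ENNReal.ofReal_ne_top hq)
    (weakEllENorm_le hp1 w f.val)
  rwa [ENNReal.toReal_mul, ENNReal.toReal_ofReal (by positivity)] at this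

/-! Write `X(Γ)` for the space. A bijection that keeps each atom in its dyadic level of weights
changes weights by a factor of at most 2 and so induces an isomorphism. Infinite levels can be
doubled in this way, and splitting `Γ` reduces the theorem to countably infinite sets
(`nonempty_equiv_prod_self_of_countable`). There, let `m(s)` be the mass of the atoms of weight at
most `s`.

If `m(s) ≤ C s` for all `s`, the norm is equivalent to `sup w ^ (1 / p) |f|`. The space is then a
rescaled `ℓ^∞(Γ)`, and any bijection of `Γ` with `Γ ⊕ Γ` suffices
(`nonempty_equiv_prod_self_of_weightMeasure_le`).

If no such `C` exists, some scales carry arbitrarily many relatively light atoms. Every finite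
weighted set can then be modelled, after scaling, by disjoint groups of atoms, and a sequence of
such sets can be placed on scales far apart (`exists_groups`). Far apart scales hardly interact: a
function constant on the groups has norm comparable to the supremum of the norms of its blocks
(`weightMeasure_lt_abs_le_of_groups`), and averaging over groups recovers the blocks. Hence
`ℓ^∞`-sums of sequences of finite spaces `X(F)` are complemented in `X(Γ)` (`exists_factorization`).
Conversely, `X(Γ)` is complemented in the `ℓ^∞`-sum `Z` of all `X(F)`, `F ⊆ Γ` finite, through
restriction and an ultrafilter limit (`limitCLM_restrictCLM`). As `ℓ^∞(Z)` is again a countable sum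
of finite spaces, Pełczyński's decomposition applies (`nonempty_equiv_prod_self_of_complemented`).
-/

/-! ### Pełczyński decomposition with `ℓ^∞`-sums. -/

/-- A uniformly bounded family of continuous linear maps induces a map into the `ℓ^∞`-sum. -/
noncomputable def lpInftyPi {ι X : Type*} {E : ι → Type*} [NormedAddCommGroup X] [NormedSpace ℝ X]
    [∀ i, NormedAddCommGroup (E i)] [∀ i, NormedSpace ℝ (E i)] (T : ∀ i, X →L[ℝ] E i) (C : ℝ)
    (hT : ∀ i x, ‖T i x‖ ≤ C * ‖x‖) : X →L[ℝ] lp E ∞ :=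
  LinearMap.mkContinuous
    { toFun := fun x => ⟨fun i => T i x, memℓp_infty ⟨C * ‖x‖, by rintro _ ⟨i, rfl⟩; exact hT i x⟩⟩
      map_add' := fun x y => by ext i; simp; rfl
      map_smul' := fun r x => by ext i; simp }
    |C| fun x => by
      refine lp.norm_le_of_forall_le (by positivity) fun i => (hT i x).trans ?_
      gcongr
      exact le_abs_self C

theorem norm_lpInftyPi_apply_le {ι X : Type*} {E : ι → Type*} [NormedAddCommGroup X]
    [NormedSpace ℝ X] [∀ i, NormedAddCommGroup (E i)] [∀ i, NormedSpace ℝ (E i)]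
    (T : ∀ i, X →L[ℝ] E i) {C : ℝ} (hC : 0 ≤ C) (hT : ∀ i x, ‖T i x‖ ≤ C * ‖x‖) (x : X) :
    ‖lpInftyPi T C hT x‖ ≤ C * ‖x‖ :=
  lp.norm_le_of_forall_le (by positivity) fun i => hT i x

/-- The first step of the Pełczyński decomposition method: a complemented subspace of `Z` can be
split off the `ℓ^∞`-sum of countably many copies of `Z`. -/
theorem nonempty_lpInfty_equiv_prod {X Z : Type*} [NormedAddCommGroup X] [NormedSpace ℝ X]
    [NormedAddCommGroup Z] [NormedSpace ℝ Z] (a : X →L[ℝ] Z) (b : Z →L[ℝ] X)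
    (hba : ∀ x, b (a x) = x) :
    Nonempty (lp (fun _ : ℕ => Z) ∞ ≃L[ℝ] (X × lp (fun _ : ℕ => Z) ∞)) := by
  -- `Q` projects `Z` onto the copy of `X`. The isomorphism keeps the `ker Q` components of a
  -- sequence in place and shifts its `X` components down by one, which releases the component at
  -- index 0 as the summand `X`; `B` shifts back.
  set Q : Z →L[ℝ] Z := a.comp b with hQ
  have hQQ : ∀ z, Q (Q z) = Q z := fun z => by simp [hQ, hba]
  have hbQ : ∀ z, b (Q z) = b z := fun z => by simp [hQ, hba]
  have hQa : ∀ x, Q (a x) = a x := fun x => by simp [hQ, hba]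
  let ev : ∀ _ : ℕ, lp (fun _ : ℕ => Z) ∞ →L[ℝ] Z := fun n => lp.evalCLM ℝ (fun _ : ℕ => Z) ∞ n
  have hev : ∀ n (y : lp (fun _ : ℕ => Z) ∞), ev n y = y n := fun n y => rfl
  have hevn : ∀ n (y : lp (fun _ : ℕ => Z) ∞), ‖y n‖ ≤ ‖y‖ := fun n y =>
    lp.norm_apply_le_norm (by simp) y n
  have hQn : ∀ z, ‖Q z‖ ≤ ‖Q‖ * ‖z‖ := Q.le_opNorm
  let S : lp (fun _ : ℕ => Z) ∞ →L[ℝ] lp (fun _ : ℕ => Z) ∞ :=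
    lpInftyPi (fun n => ev n - Q.comp (ev n) + Q.comp (ev (n + 1))) (1 + ‖Q‖ + ‖Q‖) fun n y => by
      simp only [add_apply, sub_apply,
        ContinuousLinearMap.comp_apply, hev]
      refine (norm_add_le _ _).trans ((add_le_add_left (norm_sub_le _ _) _).trans ?_)
      have h1 := (hQn (y n)).trans (mul_le_mul_of_nonneg_left (hevn n y) (norm_nonneg Q))
      have h2 := (hQn (y (n + 1))).trans (mul_le_mul_of_nonneg_left (hevn (n + 1) y) (norm_nonneg Q))
      linarith [hevn n y]
  let R : ∀ _ : ℕ, X × lp (fun _ : ℕ => Z) ∞ →L[ℝ] Z := fun n => Nat.casesOn n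
    (a.comp (ContinuousLinearMap.fst ℝ _ _) +
      ((ev 0 - Q.comp (ev 0)).comp (ContinuousLinearMap.snd ℝ _ _)))
    fun n => (Q.comp (ev n) + (ev (n + 1) - Q.comp (ev (n + 1)))).comp
      (ContinuousLinearMap.snd ℝ _ _)
  have hR0 : ∀ u, R 0 u = a u.1 + (u.2 0 - Q (u.2 0)) := fun u => rfl
  have hRs : ∀ n u, R (n + 1) u = Q (u.2 n) + (u.2 (n + 1) - Q (u.2 (n + 1))) := fun n u => rfl
  let B : X × lp (fun _ : ℕ => Z) ∞ →L[ℝ] lp (fun _ : ℕ => Z) ∞ :=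
    lpInftyPi R (‖a‖ + ‖Q‖ + 1 + ‖Q‖) fun n u => by
      have hu1 : ‖u.1‖ ≤ ‖u‖ := norm_fst_le u
      have hu2 : ∀ n, ‖u.2 n‖ ≤ ‖u‖ := fun n => (hevn n u.2).trans (norm_snd_le u)
      have h1 := (a.le_opNorm u.1).trans (mul_le_mul_of_nonneg_left hu1 (norm_nonneg a))
      have h2 := fun n => (hQn (u.2 n)).trans
        (mul_le_mul_of_nonneg_left (hu2 n) (norm_nonneg Q))
      have h3 : 0 ≤ ‖a‖ * ‖u‖ := by positivity
      have h4 : 0 ≤ ‖Q‖ * ‖u‖ := by positivity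
      rcases n with _ | n
      · rw [hR0]
        refine (norm_add_le _ _).trans ((add_le_add_right (norm_sub_le _ _) _).trans ?_)
        linarith [h2 0, hu2 0]
      · rw [hRs]
        refine (norm_add_le _ _).trans ((add_le_add_right (norm_sub_le _ _) _).trans ?_)
        linarith [h2 n, h2 (n + 1), hu2 (n + 1)]
  have hS : ∀ y n, S y n = y n - Q (y n) + Q (y (n + 1)) := fun y n => rfl
  have hB0 : ∀ u, B u 0 = a u.1 + (u.2 0 - Q (u.2 0)) := hR0
  have hBs : ∀ n u, B u (n + 1) = Q (u.2 n) + (u.2 (n + 1) - Q (u.2 (n + 1))) := hRs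
  refine ⟨ContinuousLinearEquiv.equivOfInverse ((b.comp (ev 0)).prod S) B ?_ ?_⟩
  · intro y
    refine lp.ext (funext fun n => ?_)
    rcases n with _ | n
    · rw [hB0]
      simp only [ContinuousLinearMap.prod_apply, ContinuousLinearMap.comp_apply, hev, hS, map_add,
        map_sub, hQQ]
      simp [hQ]
    · rw [hBs]
      simp only [ContinuousLinearMap.prod_apply, hS, map_add, map_sub, hQQ]
      abel
  · rintro ⟨x, g⟩
    refine Prod.ext ?_ (lp.ext (funext fun n => ?_))
    · simp only [ContinuousLinearMap.prod_apply, ContinuousLinearMap.comp_apply, hev, hB0, map_add,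
        map_sub, hbQ, hba]
      abel
    · simp only [ContinuousLinearMap.prod_apply, hS, hBs]
      rcases n with _ | n
      · simp only [hB0, map_add, map_sub, hQQ, hQa]
        abel
      · simp only [hBs, map_add, map_sub, hQQ]
        abel

/-- If `X` is complemented in `Z` and the `ℓ^∞`-sum of countably many copies of `Z` is complemented
in `X`, then `X` is isomorphic to its square. -/
theorem nonempty_equiv_prod_self_of_complemented {X Z : Type*} [NormedAddCommGroup X]
    [NormedSpace ℝ X] [NormedAddCommGroup Z] [NormedSpace ℝ Z] (a : X →L[ℝ] Z) (b : Z →L[ℝ] X)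
    (hba : ∀ x, b (a x) = x) (i : lp (fun _ : ℕ => Z) ∞ →L[ℝ] X)
    (r : X →L[ℝ] lp (fun _ : ℕ => Z) ∞) (hri : ∀ y, r (i y) = y) :
    Nonempty (X ≃L[ℝ] (X × X)) := by
  obtain ⟨Φ⟩ := nonempty_lpInfty_equiv_prod a b hba
  -- With `K = ker r` and `Y = ℓ^∞(Z)`: `X ≅ Y × K ≅ (X × Y) × K ≅ X × (Y × K) ≅ X × X`.
  let e := ContinuousLinearEquiv.equivOfRightInverse r i hri
  exact ⟨e.trans ((Φ.prodCongr (.refl ℝ _)).trans ((ContinuousLinearEquiv.prodAssoc ℝ _ _ _).trans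
    ((ContinuousLinearEquiv.refl ℝ X).prodCongr e.symm)))⟩

/-! ### Norm estimates and construction of bounded operators. -/

/-- Clearing the power of `μ(A)` leaves an inequality between finite real sums, harmless at `A = ∅`,
on which bounds for operators are checked. -/
theorem weakEllENorm_le_ofReal_iff {Γ : Type*} {p : ℝ} (w : Γ → Ioi (0 : ℝ)) (f : Γ → ℝ) {K : ℝ}
    (hK : 0 ≤ K) : weakEllENorm p w f ≤ ENNReal.ofReal K ↔
      ∀ A : Finset Γ, ∑ γ ∈ A, (w γ : ℝ) * |f γ| ≤ K * (∑ γ ∈ A, (w γ : ℝ)) ^ (1 - 1 / p) := by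
  rw [weakEllENorm, iSup_le_iff]
  refine forall_congr' fun A => ?_
  rcases A.eq_empty_or_nonempty with rfl | hne
  · simp only [Finset.sum_empty, mul_zero, zero_le, true_iff]
    positivity
  have hw : ∀ γ, (0 : ℝ) < w γ := fun γ => (w γ).2
  have hpos : 0 < ∑ γ ∈ A, (w γ : ℝ) := Finset.sum_pos (fun γ _ => hw γ) hne
  rw [weightMeasure_finset, ← ENNReal.ofReal_sum_of_nonneg fun γ _ => (hw γ).le,
    ← ENNReal.ofReal_sum_of_nonneg fun γ _ => mul_nonneg (hw γ).le (abs_nonneg _),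
    ENNReal.ofReal_rpow_of_pos hpos, ← ENNReal.ofReal_mul (by positivity),
    ENNReal.ofReal_le_ofReal_iff hK, ← neg_sub, Real.rpow_neg hpos.le, inv_mul_le_iff₀ (by positivity),
    mul_comm]

namespace WeakEll

variable {Γ : Type*} {p : ℝ} [hp : Fact (1 < p)] {w : Γ → Ioi (0 : ℝ)}

theorem val_injective : Function.Injective (val : WeakEll p w → Γ → ℝ) :=
  Subtype.val_injective

@[simp] theorem val_add (f g : WeakEll p w) : (f + g).val = f.val + g.val := rfl

@[simp] theorem val_smul (r : ℝ) (f : WeakEll p w) : (r • f).val = r • f.val := rfl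

theorem weakEllENorm_val (f : WeakEll p w) : weakEllENorm p w f.val = ENNReal.ofReal ‖f‖ :=
  (ENNReal.ofReal_toReal f.weakEllENorm_ne_top).symm

theorem sum_mul_abs_le (f : WeakEll p w) (A : Finset Γ) :
    ∑ γ ∈ A, (w γ : ℝ) * |f.val γ| ≤ ‖f‖ * (∑ γ ∈ A, (w γ : ℝ)) ^ (1 - 1 / p) :=
  (weakEllENorm_le_ofReal_iff w f.val (norm_nonneg f)).1 f.weakEllENorm_val.le A

theorem norm_le_of_weakEllENorm_le {f : WeakEll p w} {K : ℝ} (hK : 0 ≤ K)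
    (h : weakEllENorm p w f.val ≤ ENNReal.ofReal K) : ‖f‖ ≤ K := by
  rwa [weakEllENorm_val, ENNReal.ofReal_le_ofReal_iff hK] at h

/-- A linear map into functions on `Γ` which is bounded for the weak `ℓ^p` norm, as a continuous
linear map into `ℓ^{p,∞}(Γ, w)`. -/
noncomputable def mkCLM {E : Type*} [NormedAddCommGroup E] [NormedSpace ℝ E] (L : E →ₗ[ℝ] (Γ → ℝ))
    (C : ℝ) (h : ∀ x, weakEllENorm p w (L x) ≤ ENNReal.ofReal (C * ‖x‖)) : E →L[ℝ] WeakEll p w :=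
  LinearMap.mkContinuous
    (LinearMap.codRestrict (weakEllSubmodule p w) L fun x =>
      (weakLpQuasiNorm_lt_top_iff hp.out w _).2 ((h x).trans_lt ENNReal.ofReal_lt_top) :
        E →ₗ[ℝ] WeakEll p w)
    |C| fun x => norm_le_of_weakEllENorm_le (by positivity)
      ((h x).trans (ENNReal.ofReal_le_ofReal (by gcongr; exact le_abs_self C)))

theorem norm_mkCLM_apply_le {E : Type*} [NormedAddCommGroup E] [NormedSpace ℝ E]
    (L : E →ₗ[ℝ] (Γ → ℝ)) {C : ℝ} (hC : 0 ≤ C)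
    (h : ∀ x, weakEllENorm p w (L x) ≤ ENNReal.ofReal (C * ‖x‖)) (x : E) :
    ‖mkCLM L C h x‖ ≤ C * ‖x‖ :=
  norm_le_of_weakEllENorm_le (by positivity) (h x)

variable (p w) in
/-- The underlying function, as a linear map. -/
noncomputable def valₗ : WeakEll p w →ₗ[ℝ] (Γ → ℝ) := (weakEllSubmodule p w).subtype

@[simp] theorem valₗ_apply (f : WeakEll p w) : valₗ p w f = f.val := rfl

/-- The weak type estimate for an element of `ℓ^{p,∞}(Γ, w)`. -/
theorem weightMeasure_lt_abs_le (f : WeakEll p w) {K : ℝ} (hf : ‖f‖ ≤ K) {c : ℝ} (hc : 0 < c) :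
    weightMeasure w {γ | c < |f.val γ|} ≤ ENNReal.ofReal ((K / c) ^ p) := by
  have hp0 : 0 < p := zero_lt_one.trans hp.out
  have hK : 0 ≤ K := (norm_nonneg f).trans hf
  let _ : MeasurableSpace Γ := ⊤
  have h1 : ENNReal.ofReal c * weightMeasure w {γ | c < |f.val γ|} ^ (1 / p) ≤ ENNReal.ofReal K :=
    (le_iSup₂_of_le (f := fun (c : ℝ) (_ : 0 < c) =>
      ENNReal.ofReal c * weightMeasure w {x | c < |f.val x|} ^ (1 / p)) c hc le_rfl).trans
      ((weakLpQuasiNorm_le hp.out w f.val).trans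
        (f.weakEllENorm_val.le.trans (ENNReal.ofReal_le_ofReal hf)))
  rwa [mul_comm, ← ENNReal.le_div_iff_mul_le (Or.inl (by simpa using hc))
    (Or.inl ENNReal.ofReal_ne_top), one_div, ENNReal.rpow_inv_le_iff hp0,
    ← ENNReal.ofReal_div_of_pos hc, ENNReal.ofReal_rpow_of_nonneg (by positivity) hp0.le] at h1

/-- The case of a single atom. The weighted supremum norm is thus always dominated by the norm; the
reverse domination needs the mass condition of `rescaleCLM`. -/
theorem rpow_mul_abs_le (f : WeakEll p w) (γ : Γ) : (w γ : ℝ) ^ (1 / p) * |f.val γ| ≤ ‖f‖ := by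
  have hw : (0 : ℝ) < w γ := (w γ).2
  have h := f.sum_mul_abs_le {γ}
  rw [Finset.sum_singleton, Finset.sum_singleton, Real.rpow_sub hw, Real.rpow_one,
    ← mul_div_assoc, le_div_iff₀ (by positivity)] at h
  nlinarith

end WeakEll

/-- A weak type estimate bounds the norm. -/
theorem weakEllENorm_le_of_weightMeasure_le {Γ : Type*} {p : ℝ} (hp : 1 < p) (w : Γ → Ioi (0 : ℝ))
    (f : Γ → ℝ) {K : ℝ} (hK : 0 ≤ K)
    (h : ∀ c : ℝ, 0 < c → weightMeasure w {γ | c < |f γ|} ≤ ENNReal.ofReal ((K / c) ^ p)) :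
    weakEllENorm p w f ≤ ENNReal.ofReal (p / (p - 1) * K) := by
  have hp0 : 0 < p := by linarith
  have hp1 : 0 < p - 1 := by linarith
  refine (weakEllENorm_le hp w f).trans ?_
  rw [ENNReal.ofReal_mul (by positivity)]
  gcongr
  refine iSup₂_le fun c hc => ?_
  rw [mul_comm, ← ENNReal.le_div_iff_mul_le (Or.inl (by simpa using hc))
    (Or.inl ENNReal.ofReal_ne_top), one_div, ENNReal.rpow_inv_le_iff hp0,
    ← ENNReal.ofReal_div_of_pos hc, ENNReal.ofReal_rpow_of_nonneg (by positivity) hp0.le]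
  exact h c hc

/-! ### Change of index set and reduction to countable sets. -/

namespace WeakEll

variable {Γ Δ : Type*} {p : ℝ} [hp : Fact (1 < p)] {w : Γ → Ioi (0 : ℝ)} {v : Δ → Ioi (0 : ℝ)}

theorem one_sub_inv_pos {p : ℝ} [hp : Fact (1 < p)] : 0 < 1 - 1 / p := by
  have h : 1 < p := hp.out
  rw [sub_pos, div_lt_one (by linarith)]
  exact h

/-- Composition with an injection under which the weights are comparable. -/
noncomputable def compCLM (g : Δ → Γ) (hg : Function.Injective g) {C : ℝ} (hC : 0 ≤ C)
    (h₁ : ∀ δ, (v δ : ℝ) ≤ C * w (g δ)) (h₂ : ∀ δ, (w (g δ) : ℝ) ≤ C * v δ) :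
    WeakEll p w →L[ℝ] WeakEll p v :=
  -- The factor `C` comes from replacing `v` by `w` in the sum, and `C ^ (1 - 1 / p)` from the mass
  -- of the image of `A`.
  mkCLM ((LinearMap.funLeft ℝ ℝ g).comp (valₗ p w)) (C * C ^ (1 - 1 / p)) fun f => by
    have h0 : 0 < 1 - 1 / p := one_sub_inv_pos
    have hw : ∀ γ, (0 : ℝ) < w γ := fun γ => (w γ).2
    have hv : ∀ δ, (0 : ℝ) < v δ := fun δ => (v δ).2
    rw [weakEllENorm_le_ofReal_iff _ _ (by positivity)]
    intro A
    have h3 := f.sum_mul_abs_le (A.map ⟨g, hg⟩)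
    simp only [Finset.sum_map, Function.Embedding.coeFn_mk] at h3
    simp only [LinearMap.comp_apply, valₗ_apply, LinearMap.funLeft_apply]
    have h4 : 0 ≤ ∑ γ ∈ A, (w (g γ) : ℝ) := Finset.sum_nonneg fun γ _ => (hw _).le
    have h5 : 0 ≤ ∑ γ ∈ A, (v γ : ℝ) := Finset.sum_nonneg fun γ _ => (hv _).le
    calc ∑ γ ∈ A, (v γ : ℝ) * |f.val (g γ)| ≤ ∑ γ ∈ A, C * ((w (g γ) : ℝ) * |f.val (g γ)|) := by
          refine Finset.sum_le_sum fun γ _ => ?_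
          rw [← mul_assoc]
          gcongr
          exact h₁ γ
      _ = C * ∑ γ ∈ A, (w (g γ) : ℝ) * |f.val (g γ)| := by rw [Finset.mul_sum]
      _ ≤ C * (‖f‖ * (∑ γ ∈ A, C * (v γ : ℝ)) ^ (1 - 1 / p)) := by
          gcongr
          refine h3.trans ?_
          gcongr
          exact h₂ _
      _ = _ := by
          rw [← Finset.mul_sum, Real.mul_rpow hC h5]
          ring

@[simp] theorem val_compCLM (g : Δ → Γ) (hg : Function.Injective g) {C : ℝ} (hC : 0 ≤ C)
    (h₁ : ∀ δ, (v δ : ℝ) ≤ C * w (g δ)) (h₂ : ∀ δ, (w (g δ) : ℝ) ≤ C * v δ) (f : WeakEll p w) :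
    (compCLM g hg hC h₁ h₂ f).val = f.val ∘ g := rfl

theorem norm_compCLM_apply_le (g : Δ → Γ) (hg : Function.Injective g) {C : ℝ} (hC : 0 ≤ C)
    (h₁ : ∀ δ, (v δ : ℝ) ≤ C * w (g δ)) (h₂ : ∀ δ, (w (g δ) : ℝ) ≤ C * v δ) (f : WeakEll p w) :
    ‖compCLM g hg hC h₁ h₂ f‖ ≤ C * C ^ (1 - 1 / p) * ‖f‖ :=
  norm_mkCLM_apply_le _ (by positivity) _ f

/-- A bijection under which the weights are comparable induces an isomorphism. -/
theorem nonempty_equiv_of_equiv (e : Γ ≃ Δ) {C : ℝ} (hC : 0 ≤ C)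
    (h₁ : ∀ γ, (v (e γ) : ℝ) ≤ C * w γ) (h₂ : ∀ γ, (w γ : ℝ) ≤ C * v (e γ)) :
    Nonempty (WeakEll p w ≃L[ℝ] WeakEll p v) := by
  refine ⟨ContinuousLinearEquiv.equivOfInverse
    (compCLM e.symm e.symm.injective hC (fun δ => ?_) fun δ => ?_)
    (compCLM e e.injective hC h₂ h₁) (fun f => ?_) fun f => ?_⟩
  · simpa using h₁ (e.symm δ)
  · simpa using h₂ (e.symm δ)
  · exact val_injective (by ext; simp)
  · exact val_injective (by ext; simp)

/-- Extension by zero along an injection preserving the weights. -/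
noncomputable def extendCLM (g : Δ → Γ) (hg : Function.Injective g) (h : ∀ δ, w (g δ) = v δ) :
    WeakEll p v →L[ℝ] WeakEll p w :=
  mkCLM ((Function.ExtendByZero.linearMap ℝ g).comp (valₗ p v)) 1 fun f => by
    have h0 : 0 < 1 - 1 / p := one_sub_inv_pos
    have hw : ∀ γ, (0 : ℝ) < w γ := fun γ => (w γ).2
    have hv : ∀ δ, (0 : ℝ) < v δ := fun δ => (v δ).2
    rw [weakEllENorm_le_ofReal_iff _ _ (by positivity), one_mul]
    intro A
    have h5 : 0 ≤ ∑ γ ∈ A.preimage g hg.injOn, (v γ : ℝ) := Finset.sum_nonneg fun γ _ => (hv _).le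
    have h6 := Finset.sum_preimage g A hg.injOn
      (fun γ => (w γ : ℝ) * |Function.extend g f.val 0 γ|) fun γ _ hγ => by
        rw [Function.extend_apply' _ _ _ (by simpa using hγ)]
        simp
    simp only [hg.extend_apply, h] at h6
    change ∑ γ ∈ A, (w γ : ℝ) * |Function.extend g f.val 0 γ| ≤ _
    rw [← h6]
    refine (f.sum_mul_abs_le _).trans ?_
    gcongr
    calc ∑ γ ∈ A.preimage g hg.injOn, (v γ : ℝ)
        = ∑ γ ∈ (A.preimage g hg.injOn).map ⟨g, hg⟩, (w γ : ℝ) := by simp [h]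
      _ ≤ ∑ γ ∈ A, (w γ : ℝ) := by
          refine Finset.sum_le_sum_of_subset_of_nonneg ?_ fun γ _ _ => (hw γ).le
          intro γ
          simp only [Finset.mem_map, Finset.mem_preimage, Function.Embedding.coeFn_mk]
          rintro ⟨δ, hδ, rfl⟩
          exact hδ

@[simp] theorem val_extendCLM (g : Δ → Γ) (hg : Function.Injective g) (h : ∀ δ, w (g δ) = v δ)
    (f : WeakEll p v) : (extendCLM g hg h f).val = Function.extend g f.val 0 := rfl

variable (p w v) in
/-- The space over a disjoint union is the product of the spaces over the two parts. -/
noncomputable def sumEquivProd : WeakEll p (Sum.elim w v) ≃L[ℝ] (WeakEll p w × WeakEll p v) :=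
  ContinuousLinearEquiv.equivOfInverse
    ((compCLM (C := 1) Sum.inl Sum.inl_injective zero_le_one (by simp) (by simp)).prod
      (compCLM (C := 1) Sum.inr Sum.inr_injective zero_le_one (by simp) (by simp)))
    ((extendCLM Sum.inl Sum.inl_injective (by simp)).comp (ContinuousLinearMap.fst ℝ _ _) +
      (extendCLM Sum.inr Sum.inr_injective (by simp)).comp (ContinuousLinearMap.snd ℝ _ _))
    (fun f => val_injective (funext fun x => by
      change Function.extend Sum.inl (f.val ∘ Sum.inl) 0 x +
        Function.extend Sum.inr (f.val ∘ Sum.inr) 0 x = f.val x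
      rcases x with x | x
      · simp [Sum.inl_injective.extend_apply, Function.extend_apply']
      · simp [Sum.inr_injective.extend_apply, Function.extend_apply']))
    fun f => Prod.ext
      (val_injective (funext fun x => by
        change Function.extend Sum.inl f.1.val 0 (Sum.inl x) +
          Function.extend Sum.inr f.2.val 0 (Sum.inl x) = f.1.val x
        simp [Sum.inl_injective.extend_apply, Function.extend_apply']))
      (val_injective (funext fun x => by
        change Function.extend Sum.inl f.1.val 0 (Sum.inr x) +
          Function.extend Sum.inr f.2.val 0 (Sum.inr x) = f.2.val x
        simp [Sum.inr_injective.extend_apply, Function.extend_apply']))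

/-- If every dyadic level of the weight is empty or infinite, then the space is isomorphic to its
square. -/
theorem nonempty_equiv_prod_self_of_levels
    (h : ∀ n : ℤ, IsEmpty {γ // Int.log 2 (w γ : ℝ) = n} ∨ Infinite {γ // Int.log 2 (w γ : ℝ) = n}) :
    Nonempty (WeakEll p w ≃L[ℝ] (WeakEll p w × WeakEll p w)) := by
  have h1 : ∀ n : ℤ, Nonempty ({γ // Int.log 2 (w γ : ℝ) = n} ≃
      {γ // Int.log 2 (w γ : ℝ) = n} ⊕ {γ // Int.log 2 (w γ : ℝ) = n}) := by
    intro n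
    rcases h n with h2 | h2
    · exact ⟨Equiv.equivOfIsEmpty _ _⟩
    · rw [← Cardinal.eq, ← Cardinal.add_def, Cardinal.add_eq_self (Cardinal.aleph0_le_mk _)]
  -- Doubling each level separately and gluing gives a bijection that preserves `Int.log 2` of the
  -- weight.
  let E : Γ ≃ Γ ⊕ Γ := (Equiv.sigmaFiberEquiv fun γ => Int.log 2 (w γ : ℝ)).symm.trans
    ((Equiv.sigmaCongrRight fun n => (h1 n).some).trans ((Equiv.sigmaSumDistrib _ _).trans
      (Equiv.sumCongr (Equiv.sigmaFiberEquiv _) (Equiv.sigmaFiberEquiv _))))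
  have hdistrib : ∀ (n : ℤ) (y : {γ // Int.log 2 (w γ : ℝ) = n} ⊕ {γ // Int.log 2 (w γ : ℝ) = n}),
      Equiv.sumCongr (Equiv.sigmaFiberEquiv fun γ => Int.log 2 (w γ : ℝ))
        (Equiv.sigmaFiberEquiv fun γ => Int.log 2 (w γ : ℝ))
        (Equiv.sigmaSumDistrib (fun n => {γ // Int.log 2 (w γ : ℝ) = n})
          (fun n => {γ // Int.log 2 (w γ : ℝ) = n}) ⟨n, y⟩) = Sum.map Subtype.val Subtype.val y := by
    rintro n (y | y) <;> rfl
  have hE : ∀ γ, Int.log 2 ((Sum.elim w w (E γ) : Ioi (0 : ℝ)) : ℝ) = Int.log 2 (w γ : ℝ) := by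
    intro γ
    have h2 : E γ = Sum.map Subtype.val Subtype.val
        ((h1 (Int.log 2 (w γ : ℝ))).some ⟨γ, rfl⟩) := hdistrib _ _
    rw [h2]
    rcases (h1 (Int.log 2 (w γ : ℝ))).some ⟨γ, rfl⟩ with x | x
    · exact x.2
    · exact x.2
  have hlog : ∀ x y : Ioi (0 : ℝ), Int.log 2 (x : ℝ) = Int.log 2 (y : ℝ) → (x : ℝ) ≤ 2 * y := by
    intro x y hxy
    have h2 := Int.lt_zpow_succ_log_self (b := 2) (by norm_num) (x : ℝ)
    have h3 := Int.zpow_log_le_self (b := 2) (by norm_num) (mem_Ioi.1 y.2)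
    rw [hxy, zpow_add_one₀ (by norm_num)] at h2
    push_cast at h2 h3
    linarith
  obtain ⟨e⟩ := nonempty_equiv_of_equiv (p := p) (w := w) (v := Sum.elim w w) E zero_le_two
    (fun γ => hlog _ _ (hE γ)) fun γ => hlog _ _ (hE γ).symm
  exact ⟨e.trans (sumEquivProd p w w)⟩

/-- If the space over every countably infinite set is isomorphic to its square, then so is the
space over every infinite set. -/
theorem nonempty_equiv_prod_self_of_countable [Infinite Γ]
    (h : ∀ S : Set Γ, Countable S → Infinite S → Nonempty (WeakEll p (fun γ : S => w γ) ≃L[ℝ]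
      (WeakEll p (fun γ : S => w γ) × WeakEll p (fun γ : S => w γ)))) :
    Nonempty (WeakEll p w ≃L[ℝ] (WeakEll p w × WeakEll p w)) := by
  classical
  set D : Set Γ := range (Infinite.natEmbedding Γ) with hD
  let N : Γ → ℤ := fun γ => Int.log 2 (w γ : ℝ)
  -- `D` only serves to make `S` infinite. The levels not absorbed by `S` are uncountable, hence
  -- still infinite without `D`.
  let S : Set Γ := D ∪ ⋃ (n : ℤ) (_ : (N ⁻¹' {n}).Countable), N ⁻¹' {n}
  have hDc : D.Countable := countable_range _
  have hS : S.Countable :=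
    hDc.union (countable_iUnion fun n => countable_iUnion fun hn => hn)
  have hSi : S.Infinite :=
    (infinite_range_of_injective (Infinite.natEmbedding Γ).injective).mono subset_union_left
  obtain ⟨e₁⟩ := h S hS hSi.to_subtype
  obtain ⟨e₂⟩ := nonempty_equiv_prod_self_of_levels (p := p) (w := fun γ : (Sᶜ : Set Γ) => w γ) <| by
    intro n
    by_cases hn : (N ⁻¹' {n}).Countable
    · left
      refine ⟨fun ⟨⟨γ, hγ⟩, h1⟩ => hγ (Or.inr ?_)⟩
      exact mem_iUnion₂.2 ⟨n, hn, h1⟩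
    · right
      have h1 : (N ⁻¹' {n} \ D).Infinite := fun h2 =>
        hn ((h2.countable.union hDc).mono (by rw [sdiff_union_self]; exact subset_union_left))
      have h2 : ∀ γ ∈ N ⁻¹' {n} \ D, γ ∈ Sᶜ := by
        rintro γ ⟨h3, h4⟩ (h5 | h5)
        · exact h4 h5
        · obtain ⟨m, hm, h6⟩ := mem_iUnion₂.1 h5
          have h7 : m = n := (mem_singleton_iff.1 h6).symm.trans h3
          exact hn (h7 ▸ hm)
      have := h1.to_subtype
      exact Infinite.of_injective (fun γ : (N ⁻¹' {n} \ D : Set Γ) =>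
        (⟨⟨γ, h2 γ γ.2⟩, γ.2.1⟩ : {γ : (Sᶜ : Set Γ) // Int.log 2 (w γ : ℝ) = n}))
        fun x y hxy => by simpa [Subtype.ext_iff] using hxy
  obtain ⟨e⟩ := nonempty_equiv_of_equiv (p := p)
    (w := Sum.elim (fun γ : S => w γ) fun γ : (Sᶜ : Set Γ) => w γ) (v := w)
    (Equiv.Set.sumCompl S) zero_le_one (by simp) (by simp)
  let f := e.symm.trans (sumEquivProd p (fun γ : S => w γ) fun γ : (Sᶜ : Set Γ) => w γ)
  exact ⟨f.trans ((e₁.prodCongr e₂).trans ((ContinuousLinearEquiv.prodProdProdComm ℝ _ _ _ _).trans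
    (f.symm.prodCongr f.symm)))⟩

end WeakEll

/-! ### Light atoms of total mass `O(s)`. -/

theorem weightMeasure_eq_tsum_indicator {Γ : Type*} (w : Γ → Ioi (0 : ℝ)) (A : Set Γ) :
    weightMeasure w A = ∑' γ, A.indicator (fun γ => ENNReal.ofReal (w γ)) γ := by
  rw [weightMeasure_apply, tsum_subtype A fun γ => ENNReal.ofReal (w γ)]

theorem weightMeasure_sumElim {Γ Δ : Type*} (w : Γ → Ioi (0 : ℝ)) (v : Δ → Ioi (0 : ℝ))
    (A : Set (Γ ⊕ Δ)) : weightMeasure (Sum.elim w v) A =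
      weightMeasure w (Sum.inl ⁻¹' A) + weightMeasure v (Sum.inr ⁻¹' A) := by
  simp only [weightMeasure_eq_tsum_indicator]
  rw [Summable.tsum_sum ENNReal.summable ENNReal.summable]
  rfl

namespace WeakEll

variable {Γ Δ : Type*} {p : ℝ} [hp : Fact (1 < p)] {w : Γ → Ioi (0 : ℝ)} {v : Δ → Ioi (0 : ℝ)}

/-- If the atoms of weight at most `s` have total mass `O(s)`, then the weak `ℓ^p` norm is
equivalent to a weighted supremum norm, and every bijection induces a bounded map. -/
noncomputable def rescaleCLM (e : Γ ≃ Δ) (C : ℝ)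
    (hv : ∀ s, weightMeasure v {δ | (v δ : ℝ) ≤ s} ≤ ENNReal.ofReal (C * s)) :
    WeakEll p w →L[ℝ] WeakEll p v :=
  mkCLM
    { toFun := fun f δ => ((w (e.symm δ) : ℝ) / v δ) ^ (1 / p) * f.val (e.symm δ)
      map_add' := fun f g => by ext; simp [mul_add]
      map_smul' := fun r f => by ext; simp [mul_left_comm] }
    (p / (p - 1) * |C| ^ (1 / p)) fun f => by
    have hp0 : 0 < p := zero_lt_one.trans hp.out
    have hw : ∀ γ, (0 : ℝ) < w γ := fun γ => (w γ).2
    have hv0 : ∀ δ, (0 : ℝ) < v δ := fun δ => (v δ).2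
    rw [mul_assoc]
    refine weakEllENorm_le_of_weightMeasure_le hp.out _ _ (by positivity) fun c hc => ?_
    -- The image `g` of `f` satisfies `v δ ^ (1 / p) * |g δ| ≤ ‖f‖` by `rpow_mul_abs_le`, so `|g|`
    -- exceeds `c` only at light atoms.
    calc _ ≤ weightMeasure v {δ | (v δ : ℝ) ≤ (‖f‖ / c) ^ p} := by
          refine measure_mono fun δ hδ => ?_
          have h1 : c < |((w (e.symm δ) : ℝ) / v δ) ^ (1 / p) * f.val (e.symm δ)| := hδ
          have h2 := f.rpow_mul_abs_le (e.symm δ)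
          have h4 := hv0 δ
          have h5 := hw (e.symm δ)
          have h3 : 0 < (v δ : ℝ) ^ (1 / p) := by positivity
          rw [abs_mul, abs_of_nonneg (by positivity), Real.div_rpow h5.le h4.le, div_mul_eq_mul_div,
            lt_div_iff₀ h3] at h1
          change (v δ : ℝ) ≤ (‖f‖ / c) ^ p
          rw [← Real.rpow_inv_le_iff_of_pos h4.le (by positivity) hp0, ← one_div, le_div_iff₀ hc]
          linarith
      _ ≤ ENNReal.ofReal (C * (‖f‖ / c) ^ p) := hv _
      _ ≤ ENNReal.ofReal ((|C| ^ (1 / p) * ‖f‖ / c) ^ p) := by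
          refine ENNReal.ofReal_le_ofReal ?_
          rw [mul_div_assoc, Real.mul_rpow (by positivity) (by positivity),
            ← Real.rpow_mul (abs_nonneg C), one_div_mul_cancel hp0.ne', Real.rpow_one]
          gcongr
          exact le_abs_self C

theorem val_rescaleCLM (e : Γ ≃ Δ) (C : ℝ)
    (hv : ∀ s, weightMeasure v {δ | (v δ : ℝ) ≤ s} ≤ ENNReal.ofReal (C * s)) (f : WeakEll p w)
    (δ : Δ) : (rescaleCLM e C hv f).val δ =
      ((w (e.symm δ) : ℝ) / v δ) ^ (1 / p) * f.val (e.symm δ) := rfl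

theorem rescaleCLM_symm_rescaleCLM (e : Γ ≃ Δ) (C : ℝ)
    (hw : ∀ s, weightMeasure w {γ | (w γ : ℝ) ≤ s} ≤ ENNReal.ofReal (C * s))
    (hv : ∀ s, weightMeasure v {δ | (v δ : ℝ) ≤ s} ≤ ENNReal.ofReal (C * s)) (f : WeakEll p w) :
    rescaleCLM e.symm C hw (rescaleCLM e C hv f) = f := by
  refine val_injective (funext fun γ => ?_)
  have h1 : (0 : ℝ) < w γ := (w γ).2
  have h2 : (0 : ℝ) < v (e γ) := (v (e γ)).2
  rw [val_rescaleCLM, val_rescaleCLM, e.symm_symm, e.symm_apply_apply, ← mul_assoc,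
    ← Real.mul_rpow (by positivity) (by positivity), div_mul_div_cancel₀ h1.ne', div_self h2.ne',
    Real.one_rpow, one_mul]

/-- If the atoms of weight at most `s` have total mass `O(s)`, then the space is isomorphic to its
square. -/
theorem nonempty_equiv_prod_self_of_weightMeasure_le [Infinite Γ] (C : ℝ)
    (hC : ∀ s, weightMeasure w {γ | (w γ : ℝ) ≤ s} ≤ ENNReal.ofReal (C * s)) :
    Nonempty (WeakEll p w ≃L[ℝ] (WeakEll p w × WeakEll p w)) := by
  obtain ⟨e⟩ : Nonempty (Γ ≃ Γ ⊕ Γ) := by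
    rw [← Cardinal.eq, ← Cardinal.add_def, Cardinal.add_eq_self (Cardinal.aleph0_le_mk _)]
  have h0 : ∀ s, ENNReal.ofReal (C * s) + ENNReal.ofReal (C * s) = ENNReal.ofReal (2 * C * s) := by
    intro s
    rw [← two_mul, mul_assoc, ENNReal.ofReal_mul zero_le_two, ENNReal.ofReal_ofNat]
  have h1 : ∀ s, weightMeasure w {γ | (w γ : ℝ) ≤ s} ≤ ENNReal.ofReal (2 * C * s) :=
    fun s => (hC s).trans (by rw [← h0]; exact le_self_add)
  have h2 : ∀ s, weightMeasure (Sum.elim w w) {γ | ((Sum.elim w w γ : Ioi (0 : ℝ)) : ℝ) ≤ s} ≤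
      ENNReal.ofReal (2 * C * s) := by
    intro s
    rw [weightMeasure_sumElim, ← h0]
    exact add_le_add (hC s) (hC s)
  exact ⟨(ContinuousLinearEquiv.equivOfInverse (rescaleCLM e _ h2) (rescaleCLM e.symm _ h1)
    (rescaleCLM_symm_rescaleCLM e _ h1 h2) (rescaleCLM_symm_rescaleCLM e.symm _ h2 h1)).trans
    (sumEquivProd p w w)⟩

end WeakEll

/-! ### Complementation in the `ℓ^∞`-sum over finite subsets. -/

theorem exists_tendsto_ultrafilter {ι : Type*} (U : Ultrafilter ι) {g : ι → ℝ} {C : ℝ}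
    (h : ∀ i, |g i| ≤ C) : ∃ y, Filter.Tendsto g U (nhds y) := by
  obtain ⟨y, -, hy⟩ := (isCompact_Icc (a := -C) (b := C)).ultrafilter_le_nhds (U.map g)
    (by
      rw [Filter.le_principal_iff]
      exact Filter.mem_map.2 (Filter.univ_mem' fun i => abs_le.1 (h i)))
  exact ⟨y, hy⟩

namespace WeakEll

variable {Γ : Type*} (p : ℝ) [hp : Fact (1 < p)] (w : Γ → Ioi (0 : ℝ))

/-- The `ℓ^∞`-sum of the spaces over the finite subsets. -/
abbrev FinsetSum : Type _ := lp (fun F : Finset Γ => WeakEll p (fun γ : F => w γ)) ∞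

/-- Restriction to all finite subsets. -/
noncomputable def restrictCLM : WeakEll p w →L[ℝ] FinsetSum p w :=
  lpInftyPi (fun F : Finset Γ => compCLM (C := 1) (fun γ : F => (γ : Γ)) Subtype.val_injective
    zero_le_one (by simp) (by simp)) _ fun F f => norm_compCLM_apply_le _ _ _ _ _ f

theorem val_restrictCLM (f : WeakEll p w) (F : Finset Γ) (γ : F) :
    (restrictCLM p w f F).val γ = f.val γ := rfl

variable {p w} in
/-- The value at `γ` of the member indexed by `F`, extended by zero. -/
noncomputable def coord (z : FinsetSum p w) (γ : Γ) (F : Finset Γ) : ℝ :=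
  open scoped Classical in if h : γ ∈ F then (z F).val ⟨γ, h⟩ else 0

-- The bound is uniform in `F` and, for fixed `A`, involves finitely many coordinates, so it
-- survives pointwise limits in `F`.
variable {p w} in
theorem sum_mul_abs_coord_le (z : FinsetSum p w) (F A : Finset Γ) :
    ∑ γ ∈ A, (w γ : ℝ) * |coord z γ F| ≤ ‖z‖ * (∑ γ ∈ A, (w γ : ℝ)) ^ (1 - 1 / p) := by
  have h0 : 0 < 1 - 1 / p := one_sub_inv_pos
  have hext : (fun γ => coord z γ F) =
      (extendCLM (w := w) (fun γ : F => (γ : Γ)) Subtype.val_injective (fun _ => rfl) (z F)).val := by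
    funext γ
    rw [val_extendCLM, coord]
    split_ifs with h
    · exact (Subtype.val_injective.extend_apply _ _ (⟨γ, h⟩ : F)).symm
    · rw [Function.extend_apply']
      · rfl
      · rintro ⟨x, rfl⟩
        exact h x.2
  have h1 := sum_mul_abs_le
    (extendCLM (w := w) (fun γ : F => (γ : Γ)) Subtype.val_injective (fun _ => rfl) (z F)) A
  rw [← hext] at h1
  refine h1.trans ?_
  have hw : 0 ≤ ∑ γ ∈ A, (w γ : ℝ) := Finset.sum_nonneg fun γ _ => (mem_Ioi.1 (w γ).2).le
  gcongr
  refine (norm_mkCLM_apply_le _ zero_le_one _ _).trans ?_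
  rw [one_mul]
  exact lp.norm_apply_le_norm (by simp) z F

variable {p w} in
theorem exists_tendsto_coord (z : FinsetSum p w) (γ : Γ) :
    ∃ y, Filter.Tendsto (coord z γ)
      (Ultrafilter.of (Filter.atTop : Filter (Finset Γ)) : Filter (Finset Γ)) (nhds y) := by
  have hw : (0 : ℝ) < w γ := (w γ).2
  refine exists_tendsto_ultrafilter _
    (C := ‖z‖ * (∑ γ ∈ {γ}, (w γ : ℝ)) ^ (1 - 1 / p) / w γ) fun F => ?_
  rw [le_div_iff₀ hw, mul_comm]
  simpa using sum_mul_abs_coord_le z F {γ}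

/-- The pointwise limit along an ultrafilter finer than the net of finite subsets. -/
noncomputable def limitCLM : FinsetSum p w →L[ℝ] WeakEll p w :=
  mkCLM
    { toFun := fun z γ => Filter.limUnder
        (Ultrafilter.of (Filter.atTop : Filter (Finset Γ)) : Filter (Finset Γ)) (coord z γ)
      map_add' := fun z z' => funext fun γ => by
        refine Filter.Tendsto.limUnder_eq ?_
        refine ((tendsto_nhds_limUnder (exists_tendsto_coord z γ)).add
          (tendsto_nhds_limUnder (exists_tendsto_coord z' γ))).congr fun F => ?_
        simp only [coord]
        split_ifs <;> simp
      map_smul' := fun r z => funext fun γ => by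
        refine Filter.Tendsto.limUnder_eq ?_
        refine ((tendsto_nhds_limUnder (exists_tendsto_coord z γ)).const_mul r).congr fun F => ?_
        simp only [coord]
        split_ifs <;> simp }
    1 fun z => by
      rw [one_mul, weakEllENorm_le_ofReal_iff _ _ (norm_nonneg z)]
      intro A
      refine le_of_tendsto (tendsto_finsetSum A fun γ _ =>
        ((tendsto_nhds_limUnder (exists_tendsto_coord z γ)).abs.const_mul (w γ : ℝ)))
        (Filter.Eventually.of_forall fun F => sum_mul_abs_coord_le z F A)

/-- The coordinate at `γ` is constant as soon as `γ ∈ F`, which holds eventually along the net of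
finite subsets. -/
theorem limitCLM_restrictCLM (f : WeakEll p w) : limitCLM p w (restrictCLM p w f) = f := by
  refine val_injective (funext fun γ => ?_)
  change Filter.limUnder _ (coord (restrictCLM p w f) γ) = f.val γ
  refine Filter.Tendsto.limUnder_eq ?_
  refine tendsto_const_nhds.congr' ?_
  have h1 : ∀ᶠ F : Finset Γ in Filter.atTop, γ ∈ F :=
    (Filter.eventually_ge_atTop {γ}).mono fun F hF => hF (Finset.mem_singleton_self γ)
  filter_upwards [Ultrafilter.of_le _ h1] with F hF
  rw [coord, dif_pos hF, val_restrictCLM]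

end WeakEll

/-! ### Selection of disjoint groups of atoms on separated scales. -/

theorem Finset.exists_pos_forall_le {α : Type*} (s : Finset α) (f : α → ℝ) (hf : ∀ x ∈ s, 0 < f x) :
    ∃ ε, 0 < ε ∧ ∀ x ∈ s, ε ≤ f x := by
  classical
  induction s using Finset.induction_on with
  | empty => exact ⟨1, one_pos, by simp⟩
  | insert a s _ ih =>
    obtain ⟨ε, h0, h1⟩ := ih fun x hx => hf x (Finset.mem_insert_of_mem hx)
    refine ⟨min ε (f a), lt_min h0 (hf a (Finset.mem_insert_self a s)), fun x hx => ?_⟩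
    rcases Finset.mem_insert.1 hx with rfl | hx
    · exact min_le_right _ _
    · exact (min_le_left _ _).trans (h1 x hx)

/-- Greedy choice of a subset with prescribed total weight, up to the size of a single atom. -/
theorem Finset.exists_subset_sum_mem_Icc {Γ : Type*} (w : Γ → ℝ) (H : Finset Γ) {s t : ℝ}
    (hs : ∀ γ ∈ H, w γ ≤ s) (hs0 : 0 ≤ s) (ht : 0 ≤ t) (hH : t ≤ ∑ γ ∈ H, w γ) :
    ∃ G ⊆ H, t ≤ ∑ γ ∈ G, w γ ∧ ∑ γ ∈ G, w γ ≤ t + s := by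
  classical
  induction H using Finset.induction_on with
  | empty => exact ⟨∅, subset_rfl, hH, by simp; positivity⟩
  | insert a H ha ih =>
    by_cases h : t ≤ ∑ γ ∈ H, w γ
    · obtain ⟨G, h1, h2⟩ := ih (fun γ hγ => hs γ (Finset.mem_insert_of_mem hγ)) h
      exact ⟨G, h1.trans (Finset.subset_insert a H), h2⟩
    · refine ⟨insert a H, subset_rfl, hH, ?_⟩
      rw [Finset.sum_insert ha]
      linarith [hs a (Finset.mem_insert_self a H)]

/-- As `s ≤ t i`, a greedy choice for `i` uses mass at most `t i + s ≤ 2 * t i`; the factor 2 in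
`hH` therefore leaves enough for the other indices. -/
theorem Finset.exists_pairwiseDisjoint_sum_mem_Icc {Γ ι : Type*} (w : Γ → ℝ) (F : Finset ι)
    (t : ι → ℝ) (H : Finset Γ) {s : ℝ} (hs : ∀ γ ∈ H, w γ ≤ s) (hs0 : 0 ≤ s)
    (ht : ∀ i ∈ F, s ≤ t i) (hH : 2 * ∑ i ∈ F, t i ≤ ∑ γ ∈ H, w γ) :
    ∃ G : ι → Finset Γ, (∀ i ∈ F, G i ⊆ H ∧ t i ≤ ∑ γ ∈ G i, w γ ∧ ∑ γ ∈ G i, w γ ≤ 2 * t i) ∧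
      (F : Set ι).PairwiseDisjoint G := by
  classical
  induction F using Finset.induction_on generalizing H with
  | empty => exact ⟨fun _ => ∅, by simp⟩
  | insert a F ha ih =>
    have hta := ht a (Finset.mem_insert_self a F)
    have htF : ∀ i ∈ F, s ≤ t i := fun i hi => ht i (Finset.mem_insert_of_mem hi)
    have htF0 : 0 ≤ ∑ i ∈ F, t i := Finset.sum_nonneg fun i hi => hs0.trans (htF i hi)
    rw [Finset.sum_insert ha] at hH
    obtain ⟨Ga, h1, h2, h3⟩ := Finset.exists_subset_sum_mem_Icc w H hs hs0 (hs0.trans hta)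
      (by linarith)
    have h4 := Finset.sum_sdiff (f := w) h1
    obtain ⟨G, h5, h6⟩ := ih (H \ Ga) (fun γ hγ => hs γ (Finset.sdiff_subset hγ)) htF
      (by linarith)
    have hne : ∀ i ∈ F, i ≠ a := fun i hi h => ha (h ▸ hi)
    refine ⟨Function.update G a Ga, fun i hi => ?_, ?_⟩
    · rcases Finset.mem_insert.1 hi with rfl | hi
      · rw [Function.update_self]
        exact ⟨h1, h2, by linarith⟩
      · rw [Function.update_of_ne (hne i hi)]
        exact ⟨(h5 i hi).1.trans Finset.sdiff_subset, (h5 i hi).2⟩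
    · rw [Finset.coe_insert, Set.pairwiseDisjoint_insert]
      refine ⟨fun i hi j hj hij => ?_, fun j hj _ => ?_⟩
      · rw [Function.onFun, Function.update_of_ne (hne i hi), Function.update_of_ne (hne j hj)]
        exact h6 hi hj hij
      · rw [Function.update_self, Function.update_of_ne (hne j hj)]
        exact Finset.disjoint_sdiff.mono_right (h5 j hj).1

theorem exists_finset_lt_sum_of_lt_weightMeasure {Γ : Type*} (w : Γ → Ioi (0 : ℝ)) {A : Set Γ}
    {x : ℝ} (h : ENNReal.ofReal x < weightMeasure w A) :
    ∃ H : Finset Γ, (H : Set Γ) ⊆ A ∧ x < ∑ γ ∈ H, (w γ : ℝ) := by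
  rw [weightMeasure_eq_iSup] at h
  simp only [lt_iSup_iff] at h
  obtain ⟨H, h1, h2⟩ := h
  refine ⟨H, h1, ?_⟩
  rw [weightMeasure_finset, ← ENNReal.ofReal_sum_of_nonneg fun γ _ => (mem_Ioi.1 (w γ).2).le] at h2
  exact (ENNReal.ofReal_lt_ofReal_iff'.1 h2).1

/-- If the mass of the atoms of weight at most `s` is not `O(s)`, then this mass is large compared
to `s` either for large `s` or for small `s`, even away from a given finite set. -/
theorem exists_finset_mul_le_sum {Γ : Type*} {w : Γ → Ioi (0 : ℝ)}
    (hw : ∀ C : ℝ, ∃ s, ENNReal.ofReal (C * s) < weightMeasure w {γ | (w γ : ℝ) ≤ s})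
    (B : Finset Γ) {N ε : ℝ} (M : ℝ) (hN : 0 ≤ N) (hε : 0 < ε) :
    ∃ s, 0 < s ∧ (M ≤ s ∨ N * s ≤ ε) ∧ ∃ H : Finset Γ, (∀ γ ∈ H, (w γ : ℝ) ≤ s) ∧ Disjoint H B ∧
      N * s ≤ ∑ γ ∈ H, (w γ : ℝ) := by
  classical
  have hw0 : ∀ γ, (0 : ℝ) < w γ := fun γ => (w γ).2
  set b := ∑ γ ∈ B, (w γ : ℝ) with hb
  have hb0 : 0 ≤ b := Finset.sum_nonneg fun γ _ => (hw0 γ).le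
  -- The surplus `b` pays for discarding the atoms of `B`.
  have hrem : ∀ s, ENNReal.ofReal (N * s + b) < weightMeasure w {γ | (w γ : ℝ) ≤ s} →
      ∃ H : Finset Γ, (∀ γ ∈ H, (w γ : ℝ) ≤ s) ∧ Disjoint H B ∧ N * s ≤ ∑ γ ∈ H, (w γ : ℝ) := by
    intro s hs
    obtain ⟨H, h1, h2⟩ := exists_finset_lt_sum_of_lt_weightMeasure w hs
    refine ⟨H \ B, fun γ hγ => h1 (Finset.sdiff_subset hγ), Finset.sdiff_disjoint, ?_⟩
    have h3 : ∑ γ ∈ H, (w γ : ℝ) ≤ ∑ γ ∈ (H \ B) ∪ B, (w γ : ℝ) :=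
      Finset.sum_le_sum_of_subset_of_nonneg (by simp) fun γ _ _ => (hw0 γ).le
    rw [Finset.sum_union Finset.sdiff_disjoint] at h3
    linarith
  set M' := max M 1 with hM'
  have hM1 : 1 ≤ M' := le_max_right _ _
  by_cases hcase : ENNReal.ofReal (N * M' + b) < weightMeasure w {γ | (w γ : ℝ) ≤ M'}
  · exact ⟨M', by linarith, Or.inl (le_max_left _ _), hrem M' hcase⟩
  obtain ⟨β, hβ, hβB⟩ := B.exists_pos_forall_le (fun γ => (w γ : ℝ)) fun γ _ => hw0 γ
  obtain ⟨δ, hδ, hδβ, hδε⟩ : ∃ δ, 0 < δ ∧ δ ≤ β ∧ N * δ ≤ ε := by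
    refine ⟨min β (ε / (N + 1)), by positivity, min_le_left _ _, ?_⟩
    calc N * min β (ε / (N + 1)) ≤ N * (ε / (N + 1)) := by gcongr; exact min_le_right _ _
      _ = ε * (N / (N + 1)) := by ring
      _ ≤ ε * 1 := by gcongr; rw [div_le_one (by linarith)]; linarith
      _ = ε := mul_one _
  -- The first constant excludes `δ ≤ s ≤ M'`, where the mass would exceed `N * M' + b` against
  -- `hcase`. The second gives `N * s + b` when `s > M' ≥ 1`.
  obtain ⟨s, hs⟩ := hw (max ((N * M' + b) / δ) (N + b))
  have hs0 : 0 < s := by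
    by_contra h
    have h1 : {γ | (w γ : ℝ) ≤ s} = ∅ :=
      eq_empty_of_forall_notMem fun γ hγ => h ((hw0 γ).trans_le hγ)
    simp [h1] at hs
  have hsN : ENNReal.ofReal ((N + b) * s) < weightMeasure w {γ | (w γ : ℝ) ≤ s} := by
    refine lt_of_le_of_lt (ENNReal.ofReal_le_ofReal ?_) hs
    gcongr
    exact le_max_right _ _
  refine ⟨s, hs0, ?_⟩
  rcases lt_or_ge s δ with hsδ | hsδ
  -- Atoms of weight at most `s < δ ≤ β` are lighter than all atoms of `B`, so disjointness is
  -- automatic.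
  · refine ⟨Or.inr (le_trans (by gcongr) hδε), ?_⟩
    obtain ⟨H, h1, h2⟩ := exists_finset_lt_sum_of_lt_weightMeasure w hsN
    refine ⟨H, fun γ hγ => h1 hγ, Finset.disjoint_left.2 fun γ h3 h4 => ?_, ?_⟩
    · have h5 : (w γ : ℝ) ≤ s := h1 h3
      linarith [hβB γ h4]
    · nlinarith
  rcases le_or_gt s M' with hsM | hsM
  · exfalso
    refine hcase (lt_of_lt_of_le (lt_of_le_of_lt (ENNReal.ofReal_le_ofReal ?_) hs)
      (measure_mono fun γ hγ => le_trans hγ hsM))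
    calc N * M' + b = (N * M' + b) / δ * δ := by field_simp
      _ ≤ max ((N * M' + b) / δ) (N + b) * s := by
        have : 0 ≤ N * M' := by positivity
        gcongr
        exact le_max_left _ _
  · refine ⟨Or.inl ((le_max_left _ _).trans hsM.le), hrem s (lt_of_le_of_lt ?_ hsN)⟩
    refine ENNReal.ofReal_le_ofReal ?_
    nlinarith

/-- Recursive choice against all earlier terms at once: `g n` is the finite set of terms of index
below `n`. -/
theorem exists_seq_of_forall_finset {α : Type*} (P : ℕ → α → Prop) (r : ℕ → α → α → Prop)
    (h : ∀ n (s : Finset α), ∃ y, P n y ∧ ∀ x ∈ s, r n x y) :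
    ∃ f : ℕ → α, (∀ n, P n (f n)) ∧ ∀ m n, m < n → r n (f m) (f n) := by
  classical
  choose c hc hr using h
  let g : ℕ → Finset α := fun n => Nat.rec ∅ (fun k s => insert (c k s) s) n
  have hg : ∀ n, g (n + 1) = insert (c n (g n)) (g n) := fun n => rfl
  have hmono : Monotone g := monotone_nat_of_le_succ fun n => by
    rw [hg]
    exact Finset.subset_insert _ _
  refine ⟨fun n => c n (g n), fun n => hc n (g n), fun m n hmn => hr n (g n) _ ?_⟩
  refine hmono (Nat.succ_le_of_lt hmn) ?_
  rw [Nat.succ_eq_add_one, hg]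
  exact Finset.mem_insert_self _ _

/-- If the mass of the atoms of weight at most `s` is not `O(s)`, then every sequence of finite
weighted sets can be found in `Γ`, up to scaling and constants, as disjoint groups of atoms on
separated scales. -/
theorem exists_groups {Γ J : Type*} {w : Γ → Ioi (0 : ℝ)}
    (hw : ∀ C : ℝ, ∃ s, ENNReal.ofReal (C * s) < weightMeasure w {γ | (w γ : ℝ) ≤ s})
    (e : J ≃ ℕ) {D : J → Type*} [∀ j, Fintype (D j)] (v : ∀ j, D j → Ioi (0 : ℝ)) :
    ∃ (a A l : J → ℝ) (G : ∀ j, D j → Finset Γ), (∀ j, 0 < l j) ∧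
      (∀ j d, a j ≤ l j * v j d) ∧ (∀ j, 2 * (l j * ∑ d, (v j d : ℝ)) ≤ A j) ∧
      (∀ j d, l j * v j d ≤ ∑ γ ∈ G j d, (w γ : ℝ)) ∧
      (∀ j d, ∑ γ ∈ G j d, (w γ : ℝ) ≤ 2 * (l j * v j d)) ∧
      (Pairwise fun x y : Σ j, D j => Disjoint (G x.1 x.2) (G y.1 y.2)) ∧
      Pairwise fun j k => 2 ^ e j * A j ≤ a k ∨ 2 ^ e k * A k ≤ a j := by
  classical
  have hv0 : ∀ j d, (0 : ℝ) < v j d := fun j d => (v j d).2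
  -- A triple holds a lower bound for the target masses of the groups, an upper bound for twice
  -- their total, and a finite set containing the groups.
  let P : J → Ioi (0 : ℝ) × ℝ × Finset Γ → Prop := fun j y =>
    ∃ (l : ℝ) (G : D j → Finset Γ), 0 < l ∧ (∀ d, (y.1 : ℝ) ≤ l * v j d) ∧
      2 * (l * ∑ d, (v j d : ℝ)) ≤ y.2.1 ∧ (∀ d, l * v j d ≤ ∑ γ ∈ G d, (w γ : ℝ)) ∧
      (∀ d, ∑ γ ∈ G d, (w γ : ℝ) ≤ 2 * (l * v j d)) ∧ (∀ d, G d ⊆ y.2.2) ∧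
      Pairwise fun d d' => Disjoint (G d) (G d')
  obtain ⟨f, hf, hr⟩ := exists_seq_of_forall_finset (fun n => P (e.symm n))
    (fun n x y => Disjoint x.2.2 y.2.2 ∧
      (2 ^ n * x.2.1 ≤ (y.1 : ℝ) ∨ 2 ^ n * y.2.1 ≤ (x.1 : ℝ))) <| by
    intro n s
    generalize e.symm n = j
    obtain ⟨m, hm, hmv⟩ := Finset.univ.exists_pos_forall_le (fun d => (v j d : ℝ))
      fun d _ => hv0 j d
    obtain ⟨ε, hε, hεs⟩ := s.exists_pos_forall_le (fun x => (x.1 : ℝ)) fun x _ => x.1.2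
    obtain ⟨M, hM⟩ := (s.image fun x => 2 ^ n * x.2.1).exists_le
    have hV : 0 ≤ ∑ d, (v j d : ℝ) := Finset.sum_nonneg fun d _ => (hv0 j d).le
    -- With `l = t / m` every target mass `l * v j d` is at least `t`, and `N * t` is twice their
    -- total. The bounds `M` and `ε / 2 ^ n` put the new scale far above or far below each earlier
    -- one.
    obtain ⟨t, ht, ht1, H, h1, h2, h3⟩ := exists_finset_mul_le_sum hw (s.biUnion fun x => x.2.2)
      (N := 2 * (∑ d, (v j d : ℝ)) / m) (ε := ε / 2 ^ n) M (by positivity) (by positivity)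
    have h4 : 2 * ∑ d, t / m * (v j d : ℝ) = 2 * (∑ d, (v j d : ℝ)) / m * t := by
      rw [← Finset.mul_sum]
      ring
    have h5 : ∀ d, t ≤ t / m * v j d := fun d => by
      rw [div_mul_eq_mul_div, le_div_iff₀ hm]
      exact mul_le_mul_of_nonneg_left (hmv d (Finset.mem_univ d)) ht.le
    obtain ⟨G, h6, h7⟩ := Finset.exists_pairwiseDisjoint_sum_mem_Icc (fun γ => (w γ : ℝ))
      Finset.univ (fun d => t / m * (v j d : ℝ)) H h1 ht.le (fun d _ => h5 d) (h4.trans_le h3)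
    refine ⟨⟨⟨t, ht⟩, 2 * (∑ d, (v j d : ℝ)) / m * t, H⟩, ⟨t / m, G, by positivity, h5, ?_,
      fun d => (h6 d (Finset.mem_univ d)).2.1, fun d => (h6 d (Finset.mem_univ d)).2.2,
      fun d => (h6 d (Finset.mem_univ d)).1,
      fun d d' hd => h7 (Finset.mem_coe.2 (Finset.mem_univ d))
        (Finset.mem_coe.2 (Finset.mem_univ d')) hd⟩, fun x hx => ⟨?_, ?_⟩⟩
    · rw [← h4, Finset.mul_sum]
    · exact (Finset.disjoint_biUnion_right _ _ _ |>.1 h2 x hx).symm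
    · refine ht1.imp (fun h => (hM _ (Finset.mem_image_of_mem _ hx)).trans h) fun h => ?_
      refine le_trans ?_ (hεs x hx)
      rw [le_div_iff₀ (by positivity)] at h
      linarith
  have hf' : ∀ j, P j (f (e j)) := fun j => by simpa using hf (e j)
  choose l G h0 h1 h2 h3 h4 h5 h6 using hf'
  have hA : ∀ j, 0 ≤ (f (e j)).2.1 := fun j => by
    refine le_trans ?_ (h2 j)
    have := Finset.sum_nonneg fun d (_ : d ∈ Finset.univ) => (hv0 j d).le
    have := h0 j
    positivity
  -- The recursion supplies the power of 2 of the later index in both alternatives; this lowers it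
  -- to that of the earlier one where needed.
  have hpow : ∀ {j k}, e j < e k → ∀ {x : ℝ}, 0 ≤ x → (2 : ℝ) ^ e j * x ≤ 2 ^ e k * x := by
    intro j k hjk x hx
    gcongr
    exact one_le_two
  have hlt : ∀ {j k}, j ≠ k → e j < e k ∨ e k < e j := fun h => lt_or_gt_of_ne (e.injective.ne h)
  refine ⟨fun j => (f (e j)).1, fun j => (f (e j)).2.1, l, G, h0, h1, h2, h3, h4, ?_, ?_⟩
  · rintro ⟨j, d⟩ ⟨k, d'⟩ hne
    by_cases hjk : j = k
    · subst hjk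
      exact h6 j fun h => hne (congrArg (Sigma.mk j) h)
    · rcases hlt hjk with h | h
      · exact (hr _ _ h).1.mono (h5 j d) (h5 k d')
      · exact (hr _ _ h).1.symm.mono (h5 j d) (h5 k d')
  · intro j k hjk
    rcases hlt hjk with h | h
    · exact (hr _ _ h).2.imp (hpow h (hA j)).trans id
    · exact (hr _ _ h).2.symm.imp id (hpow h (hA k)).trans

/-! ### Factorization through the space when the mass is not `O(s)`. -/

/-- A sum is controlled if all but at most one of its terms are bounded by a geometric series. -/
theorem tsum_ofReal_le_of_pairwise {J : Type*} (e : J ≃ ℕ) (σ : J → ℝ) {t : ℝ} (ht : 0 ≤ t)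
    (h1 : ∀ j, σ j ≤ 2 * t) (h2 : Pairwise fun j k => 2 ^ e j * σ j ≤ t ∨ 2 ^ e k * σ k ≤ t) :
    ∑' j, ENNReal.ofReal (σ j) ≤ ENNReal.ofReal (4 * t) := by
  classical
  obtain ⟨j₀, hj₀⟩ : ∃ j₀, ∀ j, j ≠ j₀ → 2 ^ e j * σ j ≤ t := by
    by_cases h : ∃ j₀, t < 2 ^ e j₀ * σ j₀
    · obtain ⟨j₀, h3⟩ := h
      exact ⟨j₀, fun j hj => (h2 hj).resolve_right (not_le.2 h3)⟩
    · push Not at h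
      -- There is no exceptional index, so any choice of `j₀` works.
      exact ⟨e.symm 0, fun j _ => h j⟩
  -- The geometric part sums to `2 * t` and the exceptional term adds at most `2 * t`.
  have hle : ∀ j, ENNReal.ofReal (σ j) ≤
      ENNReal.ofReal ((1 / 2) ^ e j * t) + if j = j₀ then ENNReal.ofReal (2 * t) else 0 := by
    intro j
    split_ifs with hj
    · exact (ENNReal.ofReal_le_ofReal (h1 j)).trans le_add_self
    · rw [add_zero]
      refine ENNReal.ofReal_le_ofReal ?_
      rw [one_div, inv_pow, ← div_eq_inv_mul, le_div_iff₀ (by positivity), mul_comm]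
      exact hj₀ j hj
  refine (ENNReal.tsum_le_tsum hle).trans ?_
  rw [ENNReal.tsum_add, tsum_ite_eq, e.tsum_eq fun n => ENNReal.ofReal ((1 / 2) ^ n * t),
    ← ENNReal.ofReal_tsum_of_nonneg (fun n => by positivity) (summable_geometric_two.mul_right t),
    tsum_mul_right, tsum_geometric_two, ← ENNReal.ofReal_add (by positivity) (by positivity)]
  exact ENNReal.ofReal_le_ofReal (by linarith)

namespace WeakEll

variable {Γ : Type*} {p : ℝ} [hp : Fact (1 < p)] {w : Γ → Ioi (0 : ℝ)}

/-- Averaging over disjoint groups of atoms. -/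
noncomputable def averageCLM {D : Type*} {v : D → Ioi (0 : ℝ)} {l : ℝ} (hl : 0 < l)
    (G : D → Finset Γ) (hG : Pairwise fun d d' => Disjoint (G d) (G d'))
    (h₁ : ∀ d, l * v d ≤ ∑ γ ∈ G d, (w γ : ℝ))
    (h₂ : ∀ d, ∑ γ ∈ G d, (w γ : ℝ) ≤ 2 * (l * v d)) : WeakEll p w →L[ℝ] WeakEll p v :=
  mkCLM
    { toFun := fun f d =>
        l ^ (1 / p) * ((∑ γ ∈ G d, (w γ : ℝ) * f.val γ) / ∑ γ ∈ G d, (w γ : ℝ))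
      map_add' := fun f g => by
        ext d
        simp only [val_add, Pi.add_apply, mul_add, Finset.sum_add_distrib, add_div]
      map_smul' := fun r f => by
        ext d
        simp only [val_smul, Pi.smul_apply, smul_eq_mul, RingHom.id_apply, mul_left_comm _ r,
          ← Finset.mul_sum, mul_div_assoc] }
    -- The 2 is the excess mass allowed by `h₂`; the powers of `l` cancel, since `l ^ (1 / p) / l *
    -- l ^ (1 - 1 / p) = 1`.
    (2 ^ (1 - 1 / p)) fun f => by
      classical
      have h0 : 0 < 1 - 1 / p := one_sub_inv_pos
      have hw : ∀ γ, (0 : ℝ) < w γ := fun γ => (w γ).2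
      have hv : ∀ d, (0 : ℝ) < v d := fun d => (v d).2
      rw [weakEllENorm_le_ofReal_iff _ _ (by positivity)]
      intro A
      have hA : 0 ≤ ∑ d ∈ A, (v d : ℝ) := Finset.sum_nonneg fun d _ => (hv d).le
      have hdisj : (A : Set D).PairwiseDisjoint G := fun d _ d' _ hd => hG hd
      have hterm : ∀ d, (v d : ℝ) *
          |l ^ (1 / p) * ((∑ γ ∈ G d, (w γ : ℝ) * f.val γ) / ∑ γ ∈ G d, (w γ : ℝ))| ≤
          l ^ (1 / p) / l * ∑ γ ∈ G d, (w γ : ℝ) * |f.val γ| := by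
        intro d
        have h3 : 0 < ∑ γ ∈ G d, (w γ : ℝ) := (mul_pos hl (hv d)).trans_le (h₁ d)
        have h4 : |∑ γ ∈ G d, (w γ : ℝ) * f.val γ| ≤ ∑ γ ∈ G d, (w γ : ℝ) * |f.val γ| := by
          refine (Finset.abs_sum_le_sum_abs _ _).trans (Finset.sum_le_sum fun γ _ => ?_)
          rw [abs_mul, abs_of_pos (hw γ)]
        have h5 : (v d : ℝ) / ∑ γ ∈ G d, (w γ : ℝ) ≤ 1 / l := by
          rw [div_le_div_iff₀ h3 hl, one_mul, mul_comm]
          exact h₁ d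
        rw [abs_mul, abs_div, abs_of_pos h3, abs_of_pos (by positivity)]
        calc _ = l ^ (1 / p) * ((v d : ℝ) / ∑ γ ∈ G d, (w γ : ℝ)) *
              |∑ γ ∈ G d, (w γ : ℝ) * f.val γ| := by ring
          _ ≤ l ^ (1 / p) * (1 / l) * ∑ γ ∈ G d, (w γ : ℝ) * |f.val γ| := by gcongr
          _ = _ := by ring
      calc _ ≤ ∑ d ∈ A, l ^ (1 / p) / l * ∑ γ ∈ G d, (w γ : ℝ) * |f.val γ| :=
            Finset.sum_le_sum fun d _ => hterm d
        _ = l ^ (1 / p) / l * ∑ γ ∈ A.biUnion G, (w γ : ℝ) * |f.val γ| := by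
            rw [← Finset.mul_sum, Finset.sum_biUnion hdisj]
        _ ≤ l ^ (1 / p) / l * (‖f‖ * (2 * l * ∑ d ∈ A, (v d : ℝ)) ^ (1 - 1 / p)) := by
            gcongr
            refine (f.sum_mul_abs_le _).trans ?_
            have h3 : 0 ≤ ∑ γ ∈ A.biUnion G, (w γ : ℝ) := Finset.sum_nonneg fun γ _ => (hw γ).le
            gcongr
            rw [Finset.sum_biUnion hdisj, Finset.mul_sum]
            exact Finset.sum_le_sum fun d _ => (h₂ d).trans_eq (by ring)
        _ = _ := by
            rw [Real.mul_rpow (by positivity) hA, Real.mul_rpow zero_le_two hl.le,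
              Real.rpow_sub hl, Real.rpow_one]
            have := (Real.rpow_pos_of_pos hl (1 / p)).ne'
            field_simp

theorem val_averageCLM {D : Type*} {v : D → Ioi (0 : ℝ)} {l : ℝ} (hl : 0 < l)
    (G : D → Finset Γ) (hG : Pairwise fun d d' => Disjoint (G d) (G d'))
    (h₁ : ∀ d, l * v d ≤ ∑ γ ∈ G d, (w γ : ℝ))
    (h₂ : ∀ d, ∑ γ ∈ G d, (w γ : ℝ) ≤ 2 * (l * v d)) (f : WeakEll p w) (d : D) :
    (averageCLM hl G hG h₁ h₂ f).val d =
      l ^ (1 / p) * ((∑ γ ∈ G d, (w γ : ℝ) * f.val γ) / ∑ γ ∈ G d, (w γ : ℝ)) := rfl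

/-- Functions constant on groups of atoms on separated scales, with uniformly bounded weak `ℓ^p`
norms on the individual scales, satisfy a weak type estimate. -/
theorem weightMeasure_lt_abs_le_of_groups {J : Type*} (e : J ≃ ℕ) {D : J → Type*}
    [∀ j, Fintype (D j)] {v : ∀ j, D j → Ioi (0 : ℝ)} {a A l : J → ℝ} {G : ∀ j, D j → Finset Γ}
    (hl : ∀ j, 0 < l j) (ha : ∀ j d, a j ≤ l j * v j d)
    (hA : ∀ j, 2 * (l j * ∑ d, (v j d : ℝ)) ≤ A j)
    (hG : ∀ j d, ∑ γ ∈ G j d, (w γ : ℝ) ≤ 2 * (l j * v j d))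
    (hsep : Pairwise fun j k => 2 ^ e j * A j ≤ a k ∨ 2 ^ e k * A k ≤ a j)
    (y : ∀ j, WeakEll p (v j)) {K : ℝ} (hy : ∀ j, ‖y j‖ ≤ K) (g : Γ → ℝ)
    (hg : ∀ γ, g γ ≠ 0 → ∃ j d, γ ∈ G j d ∧ |g γ| = (l j ^ (1 / p))⁻¹ * |(y j).val d|)
    {c : ℝ} (hc : 0 < c) :
    weightMeasure w {γ | c < |g γ|} ≤ ENNReal.ofReal (4 * (K / c) ^ p) := by
  classical
  have hp0 : 0 < p := zero_lt_one.trans hp.out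
  have hw : ∀ γ, (0 : ℝ) < w γ := fun γ => (w γ).2
  have hv : ∀ j d, (0 : ℝ) < v j d := fun j d => (v j d).2
  have hK : 0 ≤ K := (norm_nonneg _).trans (hy (e.symm 0))
  have : Countable J := e.injective.countable
  let _ : MeasurableSpace Γ := ⊤
  set t := (K / c) ^ p with ht
  have ht0 : 0 ≤ t := by positivity
  -- These index the groups on which `|g|` can exceed `c`; the weak type estimate for `y j` bounds
  -- their scaled mass by `t`.
  let S : ∀ j, Finset (D j) := fun j =>
    Finset.univ.filter fun d => c * l j ^ (1 / p) < |(y j).val d|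
  have hS : ∀ j, l j * ∑ d ∈ S j, (v j d : ℝ) ≤ t := by
    intro j
    have h3 := hl j
    have h4 := (y j).weightMeasure_lt_abs_le (hy j) (c := c * l j ^ (1 / p)) (by positivity)
    have h5 : {d | c * l j ^ (1 / p) < |(y j).val d|} = (S j : Set (D j)) := by
      ext d
      simp [S]
    rw [h5, weightMeasure_finset, ← ENNReal.ofReal_sum_of_nonneg fun d _ => (hv j d).le,
      ENNReal.ofReal_le_ofReal_iff (by positivity), ← div_div, Real.div_rpow (by positivity)
      (by positivity), ← Real.rpow_mul h3.le, one_div_mul_cancel hp0.ne', Real.rpow_one,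
      le_div_iff₀ h3] at h4
    linarith
  have hcover : {γ | c < |g γ|} ⊆ ⋃ j, ⋃ d ∈ S j, (G j d : Set Γ) := by
    intro γ hγ
    have h3 : c < |g γ| := hγ
    obtain ⟨j, d, h4, h5⟩ := hg γ (abs_pos.1 (hc.trans h3))
    have h6 := Real.rpow_pos_of_pos (hl j) (1 / p)
    refine mem_iUnion.2 ⟨j, mem_iUnion₂.2 ⟨d, ?_, h4⟩⟩
    rw [h5, lt_inv_mul_iff₀ h6] at h3
    simpa [S, mul_comm] using h3
  have hmeas : ∀ j, weightMeasure w (⋃ d ∈ S j, (G j d : Set Γ)) ≤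
      ENNReal.ofReal (2 * (l j * ∑ d ∈ S j, (v j d : ℝ))) := by
    intro j
    refine (measure_biUnion_finset_le _ _).trans ?_
    rw [Finset.mul_sum, Finset.mul_sum, ENNReal.ofReal_sum_of_nonneg fun d _ => by
      have := hl j; have := hv j d; positivity]
    refine Finset.sum_le_sum fun d _ => ?_
    rw [weightMeasure_finset, ← ENNReal.ofReal_sum_of_nonneg fun γ _ => (hw γ).le]
    exact ENNReal.ofReal_le_ofReal (hG j d)
  refine (measure_mono hcover).trans ((measure_iUnion_le _).trans
    ((ENNReal.tsum_le_tsum hmeas).trans ?_))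
  -- If `S k` is nonempty, one of its points already forces `a k ≤ t`, so the whole of the smaller
  -- scale `j` is negligible against `t`.
  have hsmall : ∀ j k, 2 ^ e j * A j ≤ a k → 2 ^ e j * (2 * (l j * ∑ d ∈ S j, (v j d : ℝ))) ≤ t ∨
      2 ^ e k * (2 * (l k * ∑ d ∈ S k, (v k d : ℝ))) ≤ t := by
    intro j k h
    rcases (S k).eq_empty_or_nonempty with h3 | ⟨d, hd⟩
    · right
      simpa [h3] using ht0
    · left
      calc _ ≤ 2 ^ e j * A j := by
            have := hl j
            refine mul_le_mul_of_nonneg_left (le_trans ?_ (hA j)) (by positivity)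
            gcongr
            · exact fun d _ _ => (hv j d).le
            · exact Finset.subset_univ _
        _ ≤ l k * v k d := h.trans (ha k d)
        _ ≤ l k * ∑ d ∈ S k, (v k d : ℝ) := by
            have := hl k
            gcongr
            exact Finset.single_le_sum (f := fun d => (v k d : ℝ)) (fun d _ => (hv k d).le) hd
        _ ≤ t := hS k
  refine tsum_ofReal_le_of_pairwise e _ ht0 (fun j => by linarith [hS j]) fun j k hjk => ?_
  rcases hsep hjk with h | h
  · exact hsmall j k h
  · exact (hsmall k j h).symm

/-- If the mass of the atoms of weight at most `s` is not `O(s)`, then every uniformly bounded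
sequence of maps into spaces over finite sets factors through `ℓ^{p,∞}(Γ, w)`. -/
theorem exists_factorization {J : Type*} (e : J ≃ ℕ) {D : J → Type*} [∀ j, Fintype (D j)]
    (v : ∀ j, D j → Ioi (0 : ℝ)) {E : Type*} [NormedAddCommGroup E] [NormedSpace ℝ E]
    (hw : ∀ C : ℝ, ∃ s, ENNReal.ofReal (C * s) < weightMeasure w {γ | (w γ : ℝ) ≤ s})
    (T : ∀ j, E →L[ℝ] WeakEll p (v j)) (hT : ∀ j x, ‖T j x‖ ≤ ‖x‖) :
    ∃ (i : E →L[ℝ] WeakEll p w) (R : ∀ j, WeakEll p w →L[ℝ] WeakEll p (v j)) (C : ℝ), 0 ≤ C ∧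
      (∀ j f, ‖R j f‖ ≤ C * ‖f‖) ∧ ∀ j x, R j (i x) = T j x := by
  classical
  have hp0 : 0 < p := zero_lt_one.trans hp.out
  obtain ⟨a, A, l, G, hl, ha, hA, hG₁, hG₂, hdisj, hsep⟩ := exists_groups hw e v
  -- By disjointness `γ` lies in at most one group; `o` names it, and `none` marks the atoms where
  -- the image functions vanish.
  have hidx : ∀ γ, ∃ o : Option (Σ j, D j), ∀ x, γ ∈ G x.1 x.2 ↔ o = some x := by
    intro γ
    by_cases h : ∃ x : Σ j, D j, γ ∈ G x.1 x.2
    · obtain ⟨x, hx⟩ := h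
      refine ⟨some x, fun x' => ⟨fun hx' => ?_, fun h => by cases h; exact hx⟩⟩
      by_contra hne
      exact Finset.disjoint_left.1 (hdisj fun h => hne (congrArg some h)) hx hx'
    · push Not at h
      exact ⟨none, fun x => by simp [h x]⟩
  choose o ho using hidx
  let L : E →ₗ[ℝ] (Γ → ℝ) :=
    { toFun := fun x γ => (o γ).elim 0 fun s => (l s.1 ^ (1 / p))⁻¹ * (T s.1 x).val s.2
      map_add' := fun x y => by
        ext γ
        cases h : o γ <;> simp [h, mul_add]
      map_smul' := fun r x => by
        ext γ
        cases h : o γ <;> simp [h, mul_left_comm] }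
  have hL : ∀ x j d γ, γ ∈ G j d → L x γ = (l j ^ (1 / p))⁻¹ * (T j x).val d := by
    intro x j d γ hγ
    change (o γ).elim 0 _ = _
    rw [(ho γ ⟨j, d⟩).1 hγ]
    rfl
  let i : E →L[ℝ] WeakEll p w := mkCLM L (p / (p - 1) * 4 ^ (1 / p)) fun x => by
    rw [mul_assoc]
    refine weakEllENorm_le_of_weightMeasure_le hp.out _ _ (by positivity) fun c hc => ?_
    rw [mul_div_assoc, Real.mul_rpow (by positivity) (by positivity), ← Real.rpow_mul (by norm_num),
      one_div_mul_cancel hp0.ne', Real.rpow_one]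
    refine weightMeasure_lt_abs_le_of_groups e hl ha hA hG₂ hsep (fun j => T j x)
      (fun j => hT j x) _ (fun γ hγ => ?_) hc
    cases h : o γ with
    | none =>
      refine absurd ?_ hγ
      change (o γ).elim 0 _ = 0
      rw [h]
      rfl
    | some s =>
      have h3 := (ho γ s).2 h
      have h4 := Real.rpow_pos_of_pos (hl s.1) (1 / p)
      exact ⟨s.1, s.2, h3, by rw [hL x _ _ _ h3, abs_mul, abs_of_pos (by positivity)]⟩
  refine ⟨i, fun j => averageCLM (hl j) (G j) (fun d d' h => hdisj (i := ⟨j, d⟩) (j := ⟨j, d'⟩)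
    (by simpa using h)) (hG₁ j) (hG₂ j), 2 ^ (1 - 1 / p), by positivity,
    fun j f => norm_mkCLM_apply_le _ (by positivity) _ f, fun j x => val_injective (funext fun d => ?_)⟩
  have h3 : 0 < ∑ γ ∈ G j d, (w γ : ℝ) := (mul_pos (hl j) (v j d).2).trans_le (hG₁ j d)
  have h4 := Real.rpow_pos_of_pos (hl j) (1 / p)
  -- `i x` is constant on each group, so averaging returns that constant and the powers of `l j`
  -- cancel.
  have h5 : ∑ γ ∈ G j d, (w γ : ℝ) * (i x).val γ =
      (∑ γ ∈ G j d, (w γ : ℝ)) * ((l j ^ (1 / p))⁻¹ * (T j x).val d) := by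
    rw [Finset.sum_mul]
    exact Finset.sum_congr rfl fun γ hγ => by rw [← hL x j d γ hγ]; rfl
  refine (val_averageCLM (hl j) (G j) _ (hG₁ j) (hG₂ j) (i x) d).trans ?_
  rw [h5]
  field_simp

/-- If the mass of the atoms of weight at most `s` is not `O(s)`, then the space over a countable set
is isomorphic to its square. -/
theorem nonempty_equiv_prod_self_of_not_le [Countable Γ]
    (hw : ∀ C : ℝ, ∃ s, ENNReal.ofReal (C * s) < weightMeasure w {γ | (w γ : ℝ) ≤ s}) :
    Nonempty (WeakEll p w ≃L[ℝ] (WeakEll p w × WeakEll p w)) := by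
  -- Countability of `Γ` lets all pairs of a copy number and a finite subset be enumerated, so
  -- evaluation at these pairs, which determines an element of `ℓ^∞(Z)`, can be factored through
  -- `X`.
  obtain ⟨e⟩ : Nonempty (ℕ × Finset Γ ≃ ℕ) := nonempty_equiv_of_countable
  obtain ⟨i, R, C, hC, hR, hRi⟩ := exists_factorization (p := p) (w := w)
    (E := lp (fun _ : ℕ => FinsetSum p w) ∞) e (D := fun j => j.2) (fun j γ => w γ) hw
    (fun j => (lp.evalCLM ℝ (fun F : Finset Γ => WeakEll p (fun γ : F => w γ)) ∞ j.2).comp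
      (lp.evalCLM ℝ (fun _ : ℕ => FinsetSum p w) ∞ j.1)) fun j y =>
      (lp.norm_apply_le_norm (by simp) (y j.1) j.2).trans (lp.norm_apply_le_norm (by simp) y j.1)
  refine nonempty_equiv_prod_self_of_complemented (restrictCLM p w) (limitCLM p w)
    (limitCLM_restrictCLM p w) i (lpInftyPi (fun n => lpInftyPi (fun F => R (n, F)) C
      fun F f => hR (n, F) f) C fun n f => norm_lpInftyPi_apply_le _ hC _ f) fun y => ?_
  exact lp.ext (funext fun n => lp.ext (funext fun F => hRi (n, F) y))

end WeakEll

/-! ### The dichotomy on countable subsets. -/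

theorem mainTheorem10 {Γ : Type*} [Infinite Γ] (p : ℝ) [Fact (1 < p)] (w : Γ → Ioi (0 : ℝ)) :
    Nonempty (WeakEll p w ≃L[ℝ] (WeakEll p w × WeakEll p w)) := by
  refine WeakEll.nonempty_equiv_prod_self_of_countable fun S _ _ => ?_
  by_cases h : ∃ C : ℝ, ∀ s, weightMeasure (fun γ : S => w γ) {γ : S | (w γ : ℝ) ≤ s} ≤
      ENNReal.ofReal (C * s)
  · obtain ⟨C, hC⟩ := h
    exact WeakEll.nonempty_equiv_prod_self_of_weightMeasure_le C hC
  · push Not at h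
    exact WeakEll.nonempty_equiv_prod_self_of_not_le h
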